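/- Let $n\ge 1$ be an integer and let $\mu\ge 0$, $p>1$, $R\ge 1$ be real. Write $[x]_\pm=\frac{|x|\pm x}{2}$ and put $$\gamma_F(p,\nu)=2-\nu(p-1),\qquad \gamma_S(p,\nu)=2+(\nu+1)p-(\nu-1)p^2,\qquad \mu_*=\frac{n^2+n+2}{n+2},$$ $$p_F(\nu)=\begin{cases}1+\frac2\nu,&\nu>0,\\+\infty,&\nu\le0,\end{cases}\qquad p_S(\nu)=\begin{cases}\frac{\nu+1+\sqrt{\nu^2+10\nu-7}}{2(\nu-1)},&\nu>1,\\+\infty,&\nu\le1,\end{cases}$$ $$p_\mu(n)=\max\{p_F(n-[\mu-1]_-),\,p_S(n+\mu)\}.$$ For $\varepsilon>0$ consider the Cauchy problem $$u_{tt}-\Delta u+\frac{\mu}{1+t}u_t=|u|^p\ \text{ in }\mathbb R^n\times(0,T),\qquad u(x,0)=\varepsilon f(x),\quad u_t(x,0)=\varepsilon g(x).\tag{1}$$ An energy solution of (1) on $[0,T)$ is a real-valued $u\in C([0,T),H^1(\mathbb R^n))\cap C^1([0,T),L^2(\mathbb R^n))\cap C((0,T),L^p_{loc}(\mathbb R^n))$,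 with $|u|^p$ integrable on $K\times(0,t)$ for every compact $K\subset\mathbb R^n$ and every $t<T$, such that $u(\cdot,0)=\varepsilon f$, $u_t(\cdot,0)=\varepsilon g$ and $$\int_{\mathbb R^n} u_t(x,t)\phi(x,t)\,dx-\int_{\mathbb R^n}\varepsilon g(x)\phi(x,0)\,dx+\int_0^t\!\!\int_{\mathbb R^n}\{-u_t\phi_t+\nabla u\cdot\nabla\phi\}\,dx\,ds+\int_0^t\!\!\int_{\mathbb R^n}\frac{\mu}{1+s}u_t\phi\,dx\,ds=\int_0^t\!\!\int_{\mathbb R^n}|u|^p\phi\,dx\,ds$$ for all $t\in[0,T)$ and all $\phi\in C_0^\infty(\mathbb R^n\times[0,T))$. Let the blow-up time $T_\varepsilon\in[0,\infty]$ be the supremum of all $T>0$ for which (1) has an energy solution on $[0,T)$ with $\operatorname{supp}u\subset\{(x,t):|x|\le t+R\}$ (with $T_\varepsilon=0$ if there is none). **Theorem.** Let $1<p<p_\mu(n)$, $f\in H^1(\mathbb R^n)$ and $g\in L^2(\mathbb R^n)$. Assume that $f\ge0$ almost everywhere, and that $[\mu-1]_+f+g$ is nonnegative almost everywhere and is not almost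 everywhere zero. Then there are constants $\varepsilon_1>0$ and $C>0$, depending only on $f,g,\mu,n,p,R$, such that for all $0<\varepsilon\le\varepsilon_1$: * if $\mu<\mu_*$, then (with $\frac{2}{n-|\mu-1|}:=+\infty$ for $n=1$, $\mu=0$; otherwise $n-|\mu-1|>0$) $$T_\varepsilon\le\begin{cases}C\,\varepsilon^{-(p-1)/\gamma_F(p,\,n-[\mu-1]_-)},& p\le\frac{2}{n-|\mu-1|},\\ C\,\varepsilon^{-2p(p-1)/\gamma_S(p,\,n+\mu)},& p>\frac{2}{n-|\mu-1|};\end{cases}$$ * if $\mu\ge\mu_*$, then $$T_\varepsilon\le C\,\varepsilon^{-(p-1)/\gamma_F(p,n)}=C\,\varepsilon^{-[2/(p-1)-n]^{-1}};$$ * if $\mu=n=1$ and $p\le2$, then moreover $T_\varepsilon\le C\,\phi_0(\varepsilon)$, where $\phi_0=\phi_0(\varepsilon)$ is the unique positive solution of $$\varepsilon\,\phi_0^{\frac{2}{p-1}-1}\ln(1+\phi_0)=1.$$ -/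

import Mathlib

open MeasureTheory Set Filter
open scoped Topology ENNReal ContDiff

noncomputable section

namespace DampedWave

/-- The spatial domain `ℝⁿ` with its Euclidean norm. -/
abbrev Space (n : ℕ) : Type := EuclideanSpace ℝ (Fin n)

/-- The Fujita exponent `p_F(ν)`, with value `+∞` for `ν ≤ 0`. -/
def pFujita (ν : ℝ) : EReal :=
  if 0 < ν then ((1 + 2 / ν : ℝ) : EReal) else ⊤

/-- The Strauss exponent `p_S(ν)`, with value `+∞` for `ν ≤ 1`. -/
def pStrauss (ν : ℝ) : EReal :=
  if 1 < ν then (((ν + 1 + Real.sqrt (ν ^ 2 + 10 * ν - 7)) / (2 * (ν - 1)) : ℝ) : EReal) else ⊤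

/-- `γ_F(p, ν) = 2 - ν (p - 1)`. -/
def gammaF (p ν : ℝ) : ℝ := 2 - ν * (p - 1)

/-- `γ_S(p, ν) = 2 + (ν + 1) p - (ν - 1) p²`. -/
def gammaS (p ν : ℝ) : ℝ := 2 + (ν + 1) * p - (ν - 1) * p ^ 2

/-- The threshold `μ_*(n) = (n² + n + 2) / (n + 2)`. -/
def muStar (n : ℕ) : ℝ := ((n : ℝ) ^ 2 + n + 2) / (n + 2)

/-- The exponent `p_μ(n) = max {p_F(n - [μ - 1]₋), p_S(n + μ)}`. -/
def pCrit (n : ℕ) (μ : ℝ) : EReal :=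
  max (pFujita (n - (μ - 1)⁻)) (pStrauss (n + μ))

/-- `G` is the weak gradient of `w` on `ℝⁿ`: `∫ w ∇ψ = - ∫ ψ G` for all `ψ ∈ C_c^∞(ℝⁿ)`. -/
def IsWeakGradient {n : ℕ} (w : Space n → ℝ) (G : Space n → Space n) : Prop :=
  ∀ ψ : Space n → ℝ, ContDiff ℝ ∞ ψ → HasCompactSupport ψ →
    ∫ x, w x • gradient ψ x = - ∫ x, ψ x • G x

/-- Membership in the Sobolev space `H¹(ℝⁿ)`. -/
def MemH1 {n : ℕ} (w : Space n → ℝ) : Prop :=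
  MemLp w 2 volume ∧ ∃ G : Space n → Space n, MemLp G 2 volume ∧ IsWeakGradient w G

/-- `u ∈ C((0,T), L^p_loc(ℝⁿ))`: on every compact set `K`, `u(t)` belongs to `L^p(K)` and depends
continuously on `t ∈ (0,T)` in `L^p(K)`. -/
def ContinuousIntoLpLoc {n : ℕ} (p T : ℝ) (u : ℝ → Space n → ℝ) : Prop :=
  ∀ K : Set (Space n), IsCompact K → ∀ t ∈ Ioo 0 T,
    MemLp (u t) (ENNReal.ofReal p) (volume.restrict K) ∧
    Tendsto (fun s => eLpNorm (fun x => u s x - u t x) (ENNReal.ofReal p) (volume.restrict K))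
      (𝓝[Ioo 0 T] t) (𝓝 0)

/-- `u` is an energy solution on `[0,T)` of
`u_tt - Δu + μ / (1 + t) u_t = |u|^p`, `u(0) = ε f`, `u_t(0) = ε g`.
Here `ut` is the time derivative of `u` in `L²` and `Du` is its spatial weak gradient; as the
latter is unique, `u ∈ C([0,T), H¹)` says that `u` and `Du` are continuous into `L²`.
Test functions in `C_0^∞(ℝⁿ × [0,T))` are the restrictions to `t ≥ 0` of smooth functions on
`ℝⁿ × ℝ` with compact support in `ℝⁿ × (-∞,T)`. -/
structure IsEnergySolution {n : ℕ} (μ p ε : ℝ) (f g : Space n → ℝ) (T : ℝ)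
    (u : ℝ → Lp ℝ 2 (volume : Measure (Space n))) : Prop where
  continuousIntoLpLoc : ContinuousIntoLpLoc p T (fun t => u t)
  /-- The nonlinearity is integrable on bounded sets up to `t = 0`, so that the right-hand side of
  the weak identity makes sense. -/
  integrable_nonlinearity : ∀ K : Set (Space n), IsCompact K → ∀ t ∈ Ico 0 T,
    IntervalIntegrable (fun s => ∫ x in K, |u s x| ^ p) volume 0 t
  initial_value : u 0 =ᵐ[volume] fun x => ε * f x
  weak_form : ∃ (ut : ℝ → Lp ℝ 2 (volume : Measure (Space n)))
      (Du : ℝ → Lp (Space n) 2 (volume : Measure (Space n))),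
    ContinuousOn u (Ico 0 T) ∧
    (∀ t ∈ Ico 0 T, IsWeakGradient (u t) (Du t)) ∧
    ContinuousOn Du (Ico 0 T) ∧
    (∀ t ∈ Ico 0 T, HasDerivWithinAt u (ut t) (Ico 0 T) t) ∧
    ContinuousOn ut (Ico 0 T) ∧
    ut 0 =ᵐ[volume] (fun x => ε * g x) ∧
    ∀ φ : Space n × ℝ → ℝ, ContDiff ℝ ∞ φ → HasCompactSupport φ →
      tsupport φ ⊆ {z | z.2 < T} → ∀ t ∈ Ico 0 T,
        (∫ x, ut t x * φ (x, t)) - (∫ x, ε * g x * φ (x, 0))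
          + (∫ s in 0..t, ∫ x, (-(ut s x * deriv (fun τ => φ (x, τ)) s)
              + inner ℝ (Du s x) (gradient (fun y => φ (y, s)) x)))
          + (∫ s in 0..t, ∫ x, μ / (1 + s) * ut s x * φ (x, s))
        = ∫ s in 0..t, ∫ x, |u s x| ^ p * φ (x, s)

/-- `supp u ⊆ {(x,t) : |x| ≤ t + R}` for `u` on `[0,T)`. -/
def SupportedInCone {n : ℕ} (R T : ℝ) (u : ℝ → Lp ℝ 2 (volume : Measure (Space n))) : Prop :=
  ∀ t ∈ Ico 0 T, ∀ᵐ x, t + R < ‖x‖ → u t x = 0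

/-- The blow-up time `T_ε`: the supremum of all `T > 0` such that there is an energy solution on
`[0,T)` with support in `{|x| ≤ t + R}`. -/
def lifespan {n : ℕ} (μ p R : ℝ) (f g : Space n → ℝ) (ε : ℝ) : ℝ≥0∞ :=
  ⨆ T ∈ {T : ℝ | 0 < T ∧ ∃ u : ℝ → Lp ℝ 2 (volume : Measure (Space n)),
    IsEnergySolution μ p ε f g T u ∧ SupportedInCone R T u}, ENNReal.ofReal T

end DampedWave

end

/-! Blow-up is read off from the mass F(t) = ∫ u(x,t) dx. Testing the equation with functions of
time only (cut off outside the cone) gives F'' + μ/(1+t) F' = ∫ |u|^p, and Hölder's inequality on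
the ball of radius t + R bounds the right side below by a multiple of t^{-n(p-1)} |F|^p. Hence F
forces itself superlinearly. If F ≥ L on [σ,2σ], repeated use of Duhamel's formula on intervals
shrinking to 2σ makes F(2σ) infinite unless σ^{2-n(p-1)} L^{p-1} stays below a constant
(`selfForcing_lt`). Every lower bound L for F therefore limits the times σ that a solution can
reach, and each lifespan estimate is this inequality for one choice of L.

There are three choices of L. Dropping the nonlinearity, F grows at least like ε t^{1-b} with b =
min(μ,1), and like ε log(1+t) when μ = 1; this gives the Fujita-type and logarithmic bounds. For the
Strauss-type bound, take the radial solution φ of Δφ = φ, which grows like e^r r^{-(n-1)/2}. The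
moment H = ∫ u φ satisfies H'' + μ/(1+t) H' ≥ H, so H is at least of order ε t^{-μ/2} e^t
(`MomentBound.ge_exp`). Hölder's inequality against φ turns this into ∫ |u|^p ≥ c ε^p
t^{n-1-(n+μ-1)p/2}, and two integrations in time give F ≥ k ε^p t^{n+1-(n+μ-1)p/2}.

Both moments are controlled through the flux Q = (1+t)^b H' + d H with d = [μ-1]₊. Since d = 0 or b
= 1, Q' = (1+t)^b (H'' + μ/(1+t) H') formally, and ((1+t)^d H)' = (1+t)^{d-b} Q. The initial flux is
the moment of ε([μ-1]₊ f + g), which is where the sign condition on the data enters. Only the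
integrated identity for Q is used, so no second time derivative is needed. -/

namespace DampedWave

/-! ### The radial solution of Δφ = φ as a power series, and its growth -/

/-- Taylor coefficients of the entire function `z ↦ Γ(n/2) I_{n/2-1}(√z) / (√z/2)^{n/2-1}`. -/
noncomputable def besselCoeff (n k : ℕ) : ℝ :=
  ∏ j ∈ Finset.range k, (((j : ℝ) + 1) * (4 * j + 2 * n))⁻¹

/-- The entire solution of `4 z g'' + 2 n g' = g`, `g(0) = 1`. -/
noncomputable def besselSeries (n : ℕ) (z : ℝ) : ℝ := ∑' k, besselCoeff n k * z ^ k

theorem besselCoeff_zero (n : ℕ) : besselCoeff n 0 = 1 := by simp [besselCoeff]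

theorem besselCoeff_succ (n k : ℕ) :
    besselCoeff n (k + 1) = besselCoeff n k * (((k : ℝ) + 1) * (4 * k + 2 * n))⁻¹ := by
  simp [besselCoeff, Finset.prod_range_succ]

theorem besselCoeff_pos {n : ℕ} (hn : 1 ≤ n) (k : ℕ) : 0 < besselCoeff n k := by
  refine Finset.prod_pos fun j _ => ?_
  have : (1 : ℝ) ≤ n := by exact_mod_cast hn
  positivity

theorem besselCoeff_le {n : ℕ} (hn : 1 ≤ n) (k : ℕ) :
    besselCoeff n k ≤ ((k.factorial : ℝ))⁻¹ := by
  have hn' : (1 : ℝ) ≤ n := by exact_mod_cast hn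
  induction k with
  | zero => simp [besselCoeff]
  | succ k ih =>
    rw [besselCoeff_succ, Nat.factorial_succ]
    push_cast
    rw [mul_inv, mul_comm (besselCoeff n k), mul_inv]
    refine mul_le_mul ?_ ih (besselCoeff_pos hn k).le (by positivity)
    refine mul_le_of_le_one_right (by positivity) (inv_le_one_of_one_le₀ ?_)
    have : (0 : ℝ) ≤ k := by positivity
    linarith

/-- Differentiating the series termwise raises the dimension by two. All derivatives thus stay in
one family of functions, which yields both smoothness and the differential equation. -/
theorem besselCoeff_shift {n : ℕ} (hn : 1 ≤ n) (k : ℕ) :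
    ((k : ℝ) + 1) * besselCoeff n (k + 1) = besselCoeff (n + 2) k / (2 * n) := by
  have hn' : (1 : ℝ) ≤ n := by exact_mod_cast hn
  induction k with
  | zero => simp [besselCoeff]
  | succ k ih =>
    have h1 : besselCoeff n (k + 1) = besselCoeff (n + 2) k / (2 * n) / ((k : ℝ) + 1) := by
      rw [← ih]; field_simp
    rw [besselCoeff_succ n (k + 1), besselCoeff_succ (n + 2) k, h1]
    push_cast
    have : (0 : ℝ) ≤ k := by positivity
    field_simp
    ring

theorem summable_besselSeries {n : ℕ} (hn : 1 ≤ n) (z : ℝ) :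
    Summable fun k => besselCoeff n k * z ^ k := by
  refine Summable.of_norm_bounded (Real.summable_pow_div_factorial |z|) fun k => ?_
  rw [norm_mul, norm_pow, Real.norm_eq_abs, Real.norm_eq_abs, abs_of_pos (besselCoeff_pos hn k),
    div_eq_inv_mul]
  exact mul_le_mul_of_nonneg_right (besselCoeff_le hn k) (by positivity)

theorem besselSeries_zero (n : ℕ) : besselSeries n 0 = 1 := by
  rw [besselSeries, tsum_eq_single 0]
  · simp [besselCoeff]
  · intro k hk; simp [hk]

theorem one_le_besselSeries {n : ℕ} (hn : 1 ≤ n) {z : ℝ} (hz : 0 ≤ z) :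
    1 ≤ besselSeries n z := by
  have := (summable_besselSeries hn z).le_tsum 0 fun k _ =>
    mul_nonneg (besselCoeff_pos hn k).le (pow_nonneg hz k)
  simpa [besselCoeff_zero, besselSeries] using this

theorem hasDerivAt_besselSeries {n : ℕ} (hn : 1 ≤ n) (z : ℝ) :
    HasDerivAt (besselSeries n) (besselSeries (n + 2) z / (2 * n)) z := by
  have hn' : (1 : ℝ) ≤ n := by exact_mod_cast hn
  have key : ∀ k : ℕ, ∀ y : ℝ, besselCoeff n (k + 1) * (((k + 1 : ℕ) : ℝ) * y ^ k)
      = besselCoeff (n + 2) k * y ^ k / (2 * n) := by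
    intro k y
    have := besselCoeff_shift hn k
    push_cast
    rw [mul_div_right_comm, ← this]; ring
  set B := |z| + 1
  have hu : Summable fun k : ℕ => besselCoeff n k * ((k : ℝ) * B ^ (k - 1)) := by
    rw [← summable_nat_add_iff 1]
    simp only [Nat.add_sub_cancel, key]
    exact (summable_besselSeries (by omega) B).div_const _
  have h := hasDerivAt_tsum_of_isPreconnected (t := Metric.ball (0 : ℝ) B) (y₀ := 0) (y := z)
    (g := fun k y => besselCoeff n k * y ^ k)
    (g' := fun k y => besselCoeff n k * ((k : ℝ) * y ^ (k - 1))) hu Metric.isOpen_ball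
    (convex_ball _ _).isPreconnected
    (fun k y _ => (hasDerivAt_pow k y).const_mul _) ?_ (by simp [B]; positivity)
    (summable_besselSeries hn 0) (by simp [B])
  · have hsum : Summable fun k : ℕ => besselCoeff n k * ((k : ℝ) * z ^ (k - 1)) := by
      rw [← summable_nat_add_iff 1]
      simp only [Nat.add_sub_cancel, key]
      exact (summable_besselSeries (by omega) z).div_const _
    have e : ∑' k : ℕ, besselCoeff n k * ((k : ℝ) * z ^ (k - 1))
        = besselSeries (n + 2) z / (2 * n) := by
      rw [hsum.tsum_eq_zero_add]
      simp only [Nat.add_sub_cancel, key, tsum_div_const, besselSeries]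
      simp
    rw [e] at h
    exact h
  · intro k y hy
    rw [norm_mul, norm_mul, norm_pow, Real.norm_eq_abs, abs_of_pos (besselCoeff_pos hn k)]
    have hy' : ‖y‖ ≤ B := by simpa using (mem_ball_zero_iff.1 hy).le
    have := (besselCoeff_pos hn k).le
    simp only [Real.norm_natCast]
    gcongr

theorem contDiff_besselSeries {n : ℕ} (hn : 1 ≤ n) : ContDiff ℝ ∞ (besselSeries n) := by
  rw [contDiff_infty]
  intro m
  induction m generalizing n with
  | zero =>
    exact contDiff_zero.2 (continuous_iff_continuousAt.2 fun z =>
      (hasDerivAt_besselSeries hn z).continuousAt)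
  | succ m ih =>
    push_cast
    rw [contDiff_succ_iff_deriv]
    refine ⟨fun z => (hasDerivAt_besselSeries hn z).differentiableAt, by simp, ?_⟩
    have : deriv (besselSeries n) = fun z => besselSeries (n + 2) z / (2 * n) :=
      funext fun z => (hasDerivAt_besselSeries hn z).deriv
    rw [this]
    exact (ih (n := n + 2) (by omega)).div_const _

/-- Since g_n' = g_{n+2}/(2n), this is 4 z g'' + 2 n g' = g with the derivatives eliminated. -/
theorem besselSeries_ode {n : ℕ} (hn : 1 ≤ n) (z : ℝ) :
    z * besselSeries (n + 2 + 2) z / (n * (n + 2)) + besselSeries (n + 2) z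
      = besselSeries n z := by
  have hn' : (1 : ℝ) ≤ n := by exact_mod_cast hn
  have s2 := (summable_besselSeries (show 1 ≤ n + 2 by omega) z)
  have s2' := (summable_nat_add_iff 1).2 s2
  have s4 := (summable_besselSeries (show 1 ≤ n + 2 + 2 by omega) z)
  rw [besselSeries, besselSeries, besselSeries, s2.tsum_eq_zero_add,
    (summable_besselSeries hn z).tsum_eq_zero_add, mul_div_right_comm, ← tsum_mul_left,
    besselCoeff_zero, besselCoeff_zero, add_left_comm, ← Summable.tsum_add (s4.mul_left _) s2']
  congr 2
  ext k
  have a1 := besselCoeff_shift hn k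
  have a2 := besselCoeff_shift (show 1 ≤ n + 2 by omega) k
  have a3 := besselCoeff_succ (n + 2) k
  push_cast at a2 a3
  have hk : (0 : ℝ) ≤ k := by positivity
  have b1 : besselCoeff n (k + 1) = besselCoeff (n + 2) k / (2 * n) / ((k : ℝ) + 1) := by
    rw [← a1]; field_simp
  have b2 : besselCoeff (n + 2 + 2) k = ((k : ℝ) + 1) * besselCoeff (n + 2) (k + 1)
      * (2 * (n + 2)) := by
    rw [a2]; field_simp
  rw [b2, b1, a3, pow_succ]
  field_simp
  ring

/-- Passing from k to k + 1 multiplies the left side by A(B+1)/((A+1)B) with A = 2k+1 ≤ B = 2k+m+1,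
a factor at most 1. The coefficient is thus dominated by a geometric mean of 1/(2k)! and 1/(2k+m)!,
coefficients of e^r and of r^{-m} e^r; this is the source of the decay r^{-m/2}. -/
theorem besselCoeff_sq_le (m k : ℕ) :
    besselCoeff (m + 1) k ^ 2 * (2 * k).factorial * (2 * k + m).factorial ≤ m.factorial := by
  induction k with
  | zero => simp [besselCoeff]
  | succ k ih =>
    rw [besselCoeff_succ, show 2 * (k + 1) = 2 * k + 1 + 1 by ring,
      show 2 * k + 1 + 1 + m = 2 * k + m + 1 + 1 by ring, Nat.factorial_succ, Nat.factorial_succ,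
      Nat.factorial_succ (2 * k + m + 1), Nat.factorial_succ (2 * k + m)]
    refine le_trans ?_ ih
    push_cast
    have hk : (0 : ℝ) ≤ k := by positivity
    have hm : (0 : ℝ) ≤ m := by positivity
    set X := besselCoeff (m + 1) k ^ 2 * ((2 * k).factorial : ℝ) * ((2 * k + m).factorial : ℝ)
    have hX : 0 ≤ X := by positivity
    have : (besselCoeff (m + 1) k * (((k : ℝ) + 1) * (4 * k + 2 * (m + 1)))⁻¹) ^ 2 *
        ((2 * k + 1 + 1) * ((2 * k + 1) * ((2 * k).factorial : ℝ))) *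
        ((2 * k + m + 1 + 1) * ((2 * k + m + 1) * ((2 * k + m).factorial : ℝ)))
        = X * (((2 * k + 1) * (2 * k + m + 2)) / ((2 * k + 2) * (2 * k + m + 1))) := by
      simp only [X]
      field_simp
      ring
    rw [this]
    refine mul_le_of_le_one_right hX ?_
    rw [div_le_one (by positivity)]
    nlinarith

theorem tsum_even_shift_le_exp (m : ℕ) {r : ℝ} (hr : 0 ≤ r) :
    (Summable fun k : ℕ => r ^ (2 * k + m) / (2 * k + m).factorial) ∧
      ∑' k : ℕ, r ^ (2 * k + m) / (2 * k + m).factorial ≤ Real.exp r := by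
  have hs := Real.summable_pow_div_factorial r
  have hinj : Function.Injective fun k : ℕ => 2 * k + m := fun a b h => by
    simp only at h; omega
  refine ⟨hs.comp_injective hinj, ?_⟩
  rw [Real.exp_eq_exp_ℝ, NormedSpace.exp_eq_tsum_div]
  exact Summable.tsum_le_tsum_of_inj _ hinj (fun c _ => by positivity) (fun k => le_rfl)
    (hs.comp_injective hinj) hs

/-- The geometric mean is split by 2a ≤ l/P + l⁻¹ a² P with P = (2k)!. The weight l is left free, to
be balanced afterwards against the size of r. -/
theorem besselSeries_sq_le_weighted_exp (m : ℕ) {r l : ℝ} (hr : 0 ≤ r) (hl : 0 < l) (c : ℝ)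
    (s : ℕ → ℝ) (hs : Summable s) (hs' : ∑' k, s k ≤ c)
    (hsk : ∀ k : ℕ, r ^ (2 * k) / (2 * k + m).factorial ≤ s k) :
    besselSeries (m + 1) (r ^ 2) ≤ (l * Real.exp r + l⁻¹ * m.factorial * c) / 2 := by
  obtain ⟨e1, e2⟩ := tsum_even_shift_le_exp 0 hr
  simp only [add_zero] at e1 e2
  have hsum : Summable fun k : ℕ =>
      (l * (r ^ (2 * k) / (2 * k).factorial) + l⁻¹ * m.factorial * s k) / 2 :=
    ((e1.mul_left l).add (hs.mul_left _)).div_const 2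
  have h1 : besselSeries (m + 1) (r ^ 2) ≤
      ∑' k : ℕ, (l * (r ^ (2 * k) / (2 * k).factorial) + l⁻¹ * m.factorial * s k) / 2 := by
    refine Summable.tsum_le_tsum (fun k => ?_) (summable_besselSeries (by omega) _) hsum
    rw [← pow_mul]
    set a := besselCoeff (m + 1) k with ha
    set P : ℝ := ((2 * k).factorial : ℝ) with hP
    have hPpos : 0 < P := by positivity
    have hsq := besselCoeff_sq_le m k
    rw [← ha, ← hP] at hsq
    have hF : (0 : ℝ) < ((2 * k + m).factorial : ℝ) := by positivity
    have h2 : a ^ 2 * P ≤ m.factorial / (2 * k + m).factorial := by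
      rw [le_div_iff₀ hF]; exact hsq
    have h3 : 2 * a ≤ l / P + l⁻¹ * (a ^ 2 * P) := by
      have : l / P + l⁻¹ * (a ^ 2 * P) - 2 * a = (l - a * P) ^ 2 / (l * P) := by
        field_simp; ring
      have h4 : 0 ≤ (l - a * P) ^ 2 / (l * P) := by positivity
      linarith
    have hrk : 0 ≤ r ^ (2 * k) := by positivity
    have h5 : l⁻¹ * (a ^ 2 * P) ≤ l⁻¹ * (m.factorial / (2 * k + m).factorial) := by gcongr
    have h6 : l⁻¹ * m.factorial * (r ^ (2 * k) / (2 * k + m).factorial) ≤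
      l⁻¹ * m.factorial * s k := by gcongr; exact hsk k
    have h7 : 2 * a * r ^ (2 * k) ≤
        (l / P + l⁻¹ * (m.factorial / (2 * k + m).factorial)) * r ^ (2 * k) := by
      gcongr; linarith
    have h8 : (l / P + l⁻¹ * (m.factorial / (2 * k + m).factorial)) * r ^ (2 * k) =
      l * (r ^ (2 * k) / P) + l⁻¹ * m.factorial * (r ^ (2 * k) / (2 * k + m).factorial) := by
      ring
    linarith
  refine h1.trans ?_
  rw [tsum_div_const, Summable.tsum_add (e1.mul_left l) (hs.mul_left _), tsum_mul_left,
    tsum_mul_left]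
  gcongr

theorem exists_besselSeries_le (m : ℕ) : ∃ C > (0 : ℝ), ∀ r : ℝ, 0 ≤ r →
    besselSeries (m + 1) (r ^ 2) ≤ C * (1 + r) ^ (-(m : ℝ) / 2) * Real.exp r := by
  refine ⟨2 ^ ((m : ℝ) / 2) * (1 + m.factorial), by positivity, fun r hr => ?_⟩
  have hm : (0 : ℝ) ≤ m / 2 := by positivity
  have hfac : (0 : ℝ) ≤ m.factorial := by positivity
  rcases le_total r 1 with h | h
  · obtain ⟨e1, e2⟩ := tsum_even_shift_le_exp 0 hr
    simp only [add_zero] at e1 e2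
    have h1 := besselSeries_sq_le_weighted_exp m hr one_pos _ _ e1 e2 (fun k => by
      gcongr; omega)
    refine h1.trans ?_
    have h2 : 1 ≤ (2 : ℝ) ^ ((m : ℝ) / 2) * (1 + r) ^ (-(m : ℝ) / 2) := by
      rw [neg_div, Real.rpow_neg (by linarith), ← div_eq_mul_inv, one_le_div (by positivity)]
      exact Real.rpow_le_rpow (by linarith) (by linarith) hm
    have h3 : 0 ≤ (1 + m.factorial) * Real.exp r := by positivity
    nlinarith [mul_le_mul_of_nonneg_right h2 h3]
  · have hr0 : 0 < r := by linarith
    obtain ⟨e1, e2⟩ := tsum_even_shift_le_exp m hr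
    -- This l makes the two terms l e^r and l⁻¹ r^{-m} e^r of the same order. For r ≤ 1 the choice l
    -- = 1 suffices.
    have h1 := besselSeries_sq_le_weighted_exp m hr (l := r ^ (-(m : ℝ) / 2)) (by positivity)
      (Real.exp r * (r ^ m)⁻¹) (fun k => r ^ (2 * k + m) / (2 * k + m).factorial * (r ^ m)⁻¹)
      (e1.mul_right _) (by rw [tsum_mul_right]; gcongr) (fun k => by
        rw [pow_add]; apply le_of_eq; field_simp)
    refine h1.trans ?_
    have h4 : (r ^ (-(m : ℝ) / 2))⁻¹ * (r ^ m)⁻¹ = r ^ (-(m : ℝ) / 2) := by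
      rw [← Real.rpow_neg hr, ← Real.rpow_natCast, ← Real.rpow_neg hr, ← Real.rpow_add hr0]
      congr 1; ring
    have h2 : r ^ (-(m : ℝ) / 2) ≤ (2 : ℝ) ^ ((m : ℝ) / 2) * (1 + r) ^ (-(m : ℝ) / 2) := by
      rw [neg_div, Real.rpow_neg hr, Real.rpow_neg (by linarith), ← div_eq_mul_inv,
        inv_eq_one_div, div_le_div_iff₀ (by positivity) (by positivity), one_mul,
        ← Real.mul_rpow (by norm_num) hr]
      exact Real.rpow_le_rpow (by linarith) (by linarith) hm
    have h3 : 0 ≤ (1 + m.factorial) * Real.exp r := by positivity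
    have h5 := mul_le_mul_of_nonneg_right h2 h3
    have h6 : 0 ≤ r ^ (-(m : ℝ) / 2) * ((1 + m.factorial) * Real.exp r) := by positivity
    calc _ = (r ^ (-(m : ℝ) / 2) * Real.exp r +
          ((r ^ (-(m : ℝ) / 2))⁻¹ * (r ^ m)⁻¹) * m.factorial * Real.exp r) / 2 := by ring
      _ = (r ^ (-(m : ℝ) / 2) * ((1 + m.factorial) * Real.exp r)) / 2 := by rw [h4]; ring
      _ ≤ _ := by linarith

end DampedWave

/-! ### Ordinary differential inequalities for moments -/

namespace DampedWave

theorem monotoneOn_Icc_of_hasDerivWithinAt {f f' : ℝ → ℝ} {a c : ℝ}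
    (hf : ∀ t ∈ Icc a c, HasDerivWithinAt f (f' t) (Icc a c) t)
    (hf' : ∀ t ∈ Ioo a c, 0 ≤ f' t) : MonotoneOn f (Icc a c) := by
  refine monotoneOn_of_hasDerivWithinAt_nonneg (f' := f') (convex_Icc a c)
    (fun t ht => (hf t ht).continuousWithinAt) (fun t ht => ?_) (fun t ht => ?_)
  · exact (hf t (interior_subset ht)).mono interior_subset
  · rw [interior_Icc] at ht; exact hf' t ht

/-- `H` is a moment of the solution with derivative `H₁` on `[0,τ]`, and its flux
`(1+t)^b H₁ + d H`, where `b = min(μ,1)`, `d = [μ-1]₊`, is bounded below as for a solution of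
`H'' + μ/(1+t) H' ≥ e H` with initial flux at least `q`. -/
structure MomentBound (b d e q τ : ℝ) (H H₁ : ℝ → ℝ) : Prop where
  b_nonneg : 0 ≤ b
  d_nonneg : 0 ≤ d
  weights : d = 0 ∨ b = 1
  deriv : ∀ t ∈ Icc 0 τ, HasDerivWithinAt H (H₁ t) (Icc 0 τ) t
  cont : ContinuousOn H₁ (Icc 0 τ)
  init : 0 ≤ H 0
  flux : ∀ t ∈ Icc 0 τ, q + e * (∫ s in 0..t, (1 + s) ^ b * H s) ≤ (1 + t) ^ b * H₁ t + d * H t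

namespace MomentBound

variable {b d e q τ : ℝ} {H H₁ : ℝ → ℝ}

/-- The factor (1+t)^d is the integrating factor of the flux; the identity needs the alternative d =
0 or b = 1. -/
theorem hasDerivWithinAt_weighted (h : MomentBound b d e q τ H H₁) {t : ℝ} (ht : t ∈ Icc 0 τ) :
    HasDerivWithinAt (fun s => (1 + s) ^ d * H s)
      ((1 + t) ^ (d - b) * ((1 + t) ^ b * H₁ t + d * H t)) (Icc 0 τ) t := by
  have h0 : 0 < 1 + t := by linarith [ht.1]
  have h1 : HasDerivWithinAt (fun s : ℝ => (1 + s) ^ d) (1 * d * (1 + t) ^ (d - 1)) (Icc 0 τ) t :=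
    (((hasDerivAt_id t).const_add 1).rpow_const (Or.inl h0.ne')).hasDerivWithinAt
  refine (h1.mul (h.deriv t ht)).congr_deriv ?_
  rw [mul_add, ← mul_assoc, ← Real.rpow_add h0, sub_add_cancel]
  rcases h.weights with hd | hb
  · simp [hd]
  · rw [hb]; ring

theorem continuousOn (h : MomentBound b d e q τ H H₁) : ContinuousOn H (Icc 0 τ) :=
  fun t ht => (h.deriv t ht).continuousWithinAt

theorem nonneg_of_flux_pos (h : MomentBound b d e q τ H H₁) {s : ℝ} (hs : s ∈ Icc 0 τ)
    (hQ : ∀ t ∈ Ioo 0 s, 0 ≤ (1 + t) ^ b * H₁ t + d * H t) : ∀ t ∈ Icc 0 s, 0 ≤ H t := by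
  intro t ht
  have hsub : Icc 0 s ⊆ Icc 0 τ := Icc_subset_Icc_right hs.2
  have hm := monotoneOn_Icc_of_hasDerivWithinAt
    (fun r hr => (h.hasDerivWithinAt_weighted (hsub hr)).mono hsub)
    (fun r hr => mul_nonneg (Real.rpow_nonneg (by linarith [hr.1]) _) (hQ r hr))
  have h1 := hm (left_mem_Icc.2 hs.1) ht ht.1
  simp only [add_zero, Real.one_rpow, one_mul] at h1
  have h2 : 0 < (1 + t) ^ d := Real.rpow_pos_of_pos (by linarith [ht.1]) _
  exact nonneg_of_mul_nonneg_right (h.init.trans h1) h2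

theorem flux_ge_of_nonneg (h : MomentBound b d e q τ H H₁) (he : 0 ≤ e) {s : ℝ}
    (hs : s ∈ Icc 0 τ) (hH : ∀ t ∈ Icc 0 s, 0 ≤ H t) :
    q ≤ (1 + s) ^ b * H₁ s + d * H s := by
  refine le_trans ?_ (h.flux s hs)
  have : 0 ≤ ∫ r in 0..s, (1 + r) ^ b * H r :=
    intervalIntegral.integral_nonneg hs.1 fun r hr =>
      mul_nonneg (Real.rpow_nonneg (by linarith [hr.1]) _) (hH r hr)
  nlinarith [mul_nonneg he this]

/-- At a first time s where the flux is nonpositive, it is positive before s, so H ≥ 0 on [0,s];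
then the integral in the flux bound is nonnegative and the flux at s is at least q > 0, a
contradiction. -/
theorem nonneg_and_flux_ge (h : MomentBound b d e q τ H H₁) (he : 0 ≤ e) (hq : 0 < q) :
    ∀ t ∈ Icc 0 τ, 0 ≤ H t ∧ q ≤ (1 + t) ^ b * H₁ t + d * H t := by
  have hpos : ∀ t ∈ Icc 0 τ, 0 < (1 + t) ^ b * H₁ t + d * H t := by
    by_contra! hcon
    obtain ⟨t, ht, hQt⟩ := hcon
    have hcont : ContinuousOn (fun t => (1 + t) ^ b * H₁ t + d * H t) (Icc 0 τ) := by
      refine ContinuousOn.add (ContinuousOn.mul (ContinuousOn.rpow_const (by fun_prop) ?_) h.cont)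
        (continuousOn_const.mul h.continuousOn)
      intro x hx; left; linarith [hx.1]
    have hclosed : IsCompact (Icc 0 τ ∩ (fun t => (1 + t) ^ b * H₁ t + d * H t) ⁻¹' Iic 0) :=
      isCompact_Icc.of_isClosed_subset
        (hcont.preimage_isClosed_of_isClosed isClosed_Icc isClosed_Iic) inter_subset_left
    obtain ⟨s, ⟨hs, hQs⟩, hmin⟩ := hclosed.exists_isLeast ⟨t, ht, hQt⟩
    have h1 := h.flux_ge_of_nonneg he hs (h.nonneg_of_flux_pos hs fun r hr => by
      by_contra! hneg
      exact absurd (hmin ⟨⟨hr.1.le, hr.2.le.trans hs.2⟩, hneg.le⟩) (not_le.2 hr.2))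
    simp only [mem_preimage, mem_Iic] at hQs
    linarith
  intro t ht
  have hnn : ∀ r ∈ Icc 0 t, 0 ≤ H r := h.nonneg_of_flux_pos ht fun r hr =>
    (hpos r ⟨hr.1.le, hr.2.le.trans ht.2⟩).le
  exact ⟨hnn t (right_mem_Icc.2 ht.1), h.flux_ge_of_nonneg he ht hnn⟩

theorem weighted_sub_ge (h : MomentBound b d e q τ H H₁) {a t c : ℝ} (ha : 0 ≤ a)
    (hat : a ≤ t) (ht : t ≤ τ)
    (hc : ∀ s ∈ Ioo a t, c ≤ (1 + s) ^ (d - b) * ((1 + s) ^ b * H₁ s + d * H s)) :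
    (1 + a) ^ d * H a + c * (t - a) ≤ (1 + t) ^ d * H t := by
  have hsub : Icc a t ⊆ Icc 0 τ := Icc_subset_Icc ha ht
  have hm := monotoneOn_Icc_of_hasDerivWithinAt
    (fun r hr => ((h.hasDerivWithinAt_weighted (hsub hr)).mono hsub).sub
      (((hasDerivAt_id r).sub_const a).const_mul c).hasDerivWithinAt)
    (fun r hr => by have := hc r hr; linarith)
  have := hm (left_mem_Icc.2 hat) (right_mem_Icc.2 hat) hat
  simp only [id_eq, sub_self, mul_zero, sub_zero, Pi.sub_apply] at this
  linarith

/-- `H(t) ≥ c q (1+t)^{1-b}` for `t ≥ 1`. -/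
theorem ge_rpow (h : MomentBound b d e q τ H H₁) (he : 0 ≤ e) (hq : 0 < q) {t : ℝ}
    (ht1 : 1 ≤ t) (ht : t ≤ τ) : 2 ^ (-d - 2) * q * (1 + t) ^ (1 - b) ≤ H t := by
  have hb := h.b_nonneg
  have hd := h.d_nonneg
  have hp := h.nonneg_and_flux_ge he hq
  -- Integrating over [t/2,t] only keeps (1+s)^{d-b} comparable to (1+t)^{d-b}. The value at t/2 is
  -- nonnegative and is dropped; t ≥ 1 makes the length at least (1+t)/4.
  have h1 := h.weighted_sub_ge (a := t / 2) (t := t) (c := 2 ^ (-d) * (1 + t) ^ (d - b) * q)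
    (by linarith) (by linarith) ht (fun s hs => ?_)
  · have h2 := (hp (t / 2) ⟨by linarith, by linarith⟩).1
    have h3 : 0 ≤ (1 + t / 2) ^ d * H (t / 2) := mul_nonneg (by positivity) h2
    have h4 : 0 < (1 + t) ^ d := by positivity
    have h5 : (1 + t) / 4 ≤ t - t / 2 := by linarith
    have h6 : 2 ^ (-d) * (1 + t) ^ (d - b) * q * ((1 + t) / 4) ≤
      2 ^ (-d) * (1 + t) ^ (d - b) * q * (t - t / 2) := by gcongr
    have h7 : 2 ^ (-d) * (1 + t) ^ (d - b) * q * ((1 + t) / 4) =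
        (1 + t) ^ d * (2 ^ (-d - 2) * q * (1 + t) ^ (1 - b)) := by
      have e1 : (1 + t) ^ (d - b) * (1 + t) = (1 + t) ^ d * (1 + t) ^ (1 - b) := by
        rw [← Real.rpow_add (by linarith), ← Real.rpow_add_one (by linarith)]
        congr 1; ring
      have e2 : (2 : ℝ) ^ (-d - 2) = 2 ^ (-d) / 4 := by
        rw [Real.rpow_sub (by norm_num)]; norm_num
      rw [e2]
      linear_combination (2 ^ (-d) * q / 4) * e1
    refine le_of_mul_le_mul_left ?_ h4
    linarith
  · have hs0 : 0 < s := by linarith [hs.1]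
    have h2 := (hp s ⟨hs0.le, hs.2.le.trans ht⟩).2
    have h3 : 2 ^ (-d) * (1 + t) ^ (d - b) ≤ (1 + s) ^ (d - b) := by
      rw [sub_eq_add_neg, Real.rpow_add (by linarith), Real.rpow_add (by linarith), ← mul_assoc]
      refine mul_le_mul ?_ ?_ (by positivity) (by positivity)
      · rw [Real.rpow_neg (by norm_num), ← div_eq_inv_mul, div_le_iff₀ (by positivity),
          ← Real.mul_rpow (by linarith) (by norm_num)]
        exact Real.rpow_le_rpow (by linarith) (by linarith [hs.1]) hd
      · exact Real.rpow_le_rpow_of_nonpos (by linarith) (by linarith [hs.2]) (by linarith)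
    exact mul_le_mul h3 h2 hq.le (by positivity)

/-- For μ = 1 the flux is (1+t) H', so H' ≥ q/(1+t). -/
theorem ge_log (h : MomentBound 1 0 e q τ H H₁) (he : 0 ≤ e) (hq : 0 < q) {t : ℝ}
    (ht : t ∈ Icc 0 τ) : q * Real.log (1 + t) ≤ H t := by
  have hp := h.nonneg_and_flux_ge he hq
  have hm := monotoneOn_Icc_of_hasDerivWithinAt (f := fun s => H s - q * Real.log (1 + s))
    (fun r hr => (h.deriv r hr).sub
      ((((hasDerivAt_id r).const_add 1).log
        (by simp only [id_eq]; linarith [hr.1])).const_mul q).hasDerivWithinAt)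
    (fun r hr => by
      have := (hp r ⟨hr.1.le, hr.2.le⟩).2
      have h0 : 0 < 1 + r := by linarith [hr.1]
      simp only [Real.rpow_one, zero_mul, add_zero] at this
      simp only [id_eq]
      rw [sub_nonneg, mul_one_div, div_le_iff₀ h0]
      linarith)
  have := hm (left_mem_Icc.2 (ht.1.trans ht.2)) ht ht.1
  simp only [add_zero, Real.log_one, mul_zero, sub_zero] at this
  linarith [h.init]

/-- Duhamel's lower bound for a moment driven by a source `N ≥ ν` on `[a,t]`, `t ≤ 2a`. -/
theorem ge_of_source (h : MomentBound b d e q τ H H₁) (he : 0 ≤ e) (hq : 0 < q) {N : ℝ → ℝ}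
    (hN : IntervalIntegrable N volume 0 τ) (hN0 : ∀ s ∈ Icc 0 τ, 0 ≤ N s)
    (hflux : ∀ t ∈ Icc 0 τ, (∫ s in 0..t, (1 + s) ^ b * N s) ≤ (1 + t) ^ b * H₁ t + d * H t)
    {a t ν : ℝ} (ha : 1 ≤ a) (hat : a ≤ t) (hta : t ≤ 2 * a) (ht : t ≤ τ) (hν : 0 ≤ ν)
    (hNν : ∀ s ∈ Icc a t, ν ≤ N s) : 2 ^ (-(b + d) - 1) * ν * (t - a) ^ 2 ≤ H t := by
  have hb := h.b_nonneg
  have hd := h.d_nonneg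
  have hp := h.nonneg_and_flux_ge he hq
  have hsub : Icc a t ⊆ Icc 0 τ := Icc_subset_Icc (by linarith) ht
  have hflux' : ∀ s ∈ Icc a t, (1 + a) ^ b * (ν * (s - a)) ≤ (1 + s) ^ b * H₁ s + d * H s := by
    intro s hs
    refine le_trans ?_ (hflux s (hsub hs))
    have hs0 : 0 ≤ s := by linarith [hs.1]
    have hI : IntervalIntegrable (fun r => (1 + r) ^ b * N r) volume 0 s := by
      refine (hN.mono_set ?_).continuousOn_mul ?_
      · rw [uIcc_of_le hs0, uIcc_of_le (hs0.trans (hs.2.trans ht))]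
        exact Icc_subset_Icc_right (hs.2.trans ht)
      · refine ContinuousOn.rpow_const (by fun_prop) fun x _ => Or.inr hb
    have hI0 : IntervalIntegrable (fun r => (1 + r) ^ b * N r) volume 0 a := hI.mono_set (by
      rw [uIcc_of_le hs0, uIcc_of_le (by linarith)]; exact Icc_subset_Icc_right hs.1)
    have hI1 : IntervalIntegrable (fun r => (1 + r) ^ b * N r) volume a s := hI.mono_set (by
      rw [uIcc_of_le hs0, uIcc_of_le hs.1]; exact Icc_subset_Icc_left (by linarith))
    rw [← intervalIntegral.integral_add_adjacent_intervals hI0 hI1]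
    have h1 : 0 ≤ ∫ r in 0..a, (1 + r) ^ b * N r :=
      intervalIntegral.integral_nonneg (by linarith) fun r hr =>
        mul_nonneg (Real.rpow_nonneg (by linarith [hr.1]) _) (hN0 r ⟨hr.1, by linarith [hr.2]⟩)
    have h2 : ∫ _ in a..s, (1 + a) ^ b * ν ≤ ∫ r in a..s, (1 + r) ^ b * N r := by
      refine intervalIntegral.integral_mono_on hs.1 (by simp) hI1 fun r hr => ?_
      refine mul_le_mul ?_ (hNν r ⟨hr.1, hr.2.trans hs.2⟩) hν
        (Real.rpow_nonneg (by linarith [hr.1]) _)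
      exact Real.rpow_le_rpow (by linarith) (by linarith [hr.1]) hb
    rw [intervalIntegral.integral_const, smul_eq_mul] at h2
    linarith
  -- The flux grows at least linearly in s - a, so (1+s)^d H minus a suitable multiple of (s-a)² is
  -- monotone. The condition t ≤ 2a makes all weights on [a,t] comparable to those at a.
  have hm := monotoneOn_Icc_of_hasDerivWithinAt
    (fun r hr => ((h.hasDerivWithinAt_weighted (hsub hr)).mono hsub).sub
      ((((hasDerivAt_id r).sub_const a).pow 2).const_mul
        (2 ^ (-b) * (1 + a) ^ d * ν / 2)).hasDerivWithinAt)
    (fun r hr => by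
      have h1 := hflux' r ⟨hr.1.le, hr.2.le⟩
      have hr0 : 0 < r := by linarith [hr.1]
      have h2 : 2 ^ (-b) * (1 + a) ^ (d - b) ≤ (1 + r) ^ (d - b) := by
        rw [sub_eq_add_neg, Real.rpow_add (by linarith), Real.rpow_add (by linarith),
          mul_left_comm]
        refine mul_le_mul ?_ ?_ (by positivity) (by positivity)
        · exact Real.rpow_le_rpow (by linarith) (by linarith [hr.1]) hd
        · rw [← Real.mul_rpow (by norm_num) (by linarith)]
          exact Real.rpow_le_rpow_of_nonpos (by linarith) (by linarith [hr.2]) (by linarith)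
      have h3 : 0 ≤ ν * (r - a) := mul_nonneg hν (by linarith [hr.1])
      have h4 := mul_le_mul h2 h1 (by positivity) (by positivity)
      have h5 : (1 + a) ^ (d - b) * (1 + a) ^ b = (1 + a) ^ d := by
        rw [← Real.rpow_add (by linarith)]; congr 1; ring
      have h6 : 2 ^ (-b) * (1 + a) ^ (d - b) * ((1 + a) ^ b * (ν * (r - a)))
          = 2 ^ (-b) * (1 + a) ^ d * (ν * (r - a)) := by rw [← h5]; ring
      simp only [id_eq]
      push_cast
      rw [h6] at h4
      linarith)
  have h7 := hm (left_mem_Icc.2 hat) (right_mem_Icc.2 hat) hat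
  simp only [id_eq, sub_self, Pi.sub_apply, Pi.pow_apply] at h7
  have h8 : 0 ≤ (1 + a) ^ d * H a :=
    mul_nonneg (Real.rpow_nonneg (by linarith) _) (hp a (hsub (left_mem_Icc.2 hat))).1
  have h9 : (1 + t) ^ d ≤ 2 ^ d * (1 + a) ^ d := by
    rw [← Real.mul_rpow (by norm_num) (by linarith)]
    exact Real.rpow_le_rpow (by linarith) (by linarith) hd
  have h10 := mul_le_mul_of_nonneg_right h9 (hp t ⟨by linarith, ht⟩).1
  have h11 : 0 < 2 ^ d * (1 + a) ^ d :=
    mul_pos (by positivity) (Real.rpow_pos_of_pos (by linarith) _)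
  refine le_of_mul_le_mul_left ?_ h11
  have h12 : 2 ^ d * (1 + a) ^ d * (2 ^ (-(b + d) - 1) * ν * (t - a) ^ 2)
      = 2 ^ (-b) * (1 + a) ^ d * ν / 2 * (t - a) ^ 2 := by
    have : (2 : ℝ) ^ d * 2 ^ (-(b + d) - 1) = 2 ^ (-b) / 2 := by
      rw [← Real.rpow_add (by norm_num), ← Real.rpow_sub_one (by norm_num)]
      congr 1; ring
    linear_combination ((1 + a) ^ d * ν * (t - a) ^ 2) * this
  linarith

/-- Comparison with a subsolution of the homogeneous equation. -/
theorem ge_of_subsolution (h : MomentBound b d 1 q τ H H₁) {y y' y'' : ℝ → ℝ}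
    (hy : ∀ t ∈ Icc 0 τ, HasDerivAt y (y' t) t) (hy' : ∀ t ∈ Icc 0 τ, HasDerivAt y' (y'' t) t)
    (hsub : ∀ t ∈ Icc 0 τ, y'' t + (b + d) / (1 + t) * y' t ≤ y t)
    (hy0 : y 0 = 0) (hy'0 : y' 0 < q) : ∀ t ∈ Icc 0 τ, y t ≤ H t := by
  have hyc : ContinuousOn y (Icc 0 τ) := fun t ht => (hy t ht).continuousAt.continuousWithinAt
  have hy'c : ContinuousOn y' (Icc 0 τ) := fun t ht => (hy' t ht).continuousAt.continuousWithinAt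
  have hw : ContinuousOn (fun t : ℝ => (1 + t) ^ b) (Icc 0 τ) :=
    ContinuousOn.rpow_const (by fun_prop) fun x hx => Or.inr h.b_nonneg
  -- The difference H - y obeys the same flux bound with initial flux q - y'(0) > 0, so comparison
  -- reduces to positivity.
  have hB : MomentBound b d 1 (q - y' 0) τ (fun t => H t - y t) (fun t => H₁ t - y' t) :=
    { b_nonneg := h.b_nonneg
      d_nonneg := h.d_nonneg
      weights := h.weights
      deriv := fun t ht => (h.deriv t ht).sub (hy t ht).hasDerivWithinAt
      cont := h.cont.sub hy'c
      init := by simpa [hy0] using h.init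
      flux := fun t ht => by
        have hsubt : Icc 0 t ⊆ Icc 0 τ := Icc_subset_Icc_right ht.2
        have hI1 : IntervalIntegrable (fun s => (1 + s) ^ b * H s) volume 0 t := by
          refine ContinuousOn.intervalIntegrable ?_
          rw [uIcc_of_le ht.1]
          exact (hw.mul h.continuousOn).mono hsubt
        have hc2 : ContinuousOn (fun s => (1 + s) ^ b * y s) (Icc 0 t) := (hw.mul hyc).mono hsubt
        have hI2 : IntervalIntegrable (fun s => (1 + s) ^ b * y s) volume 0 t := by
          refine ContinuousOn.intervalIntegrable ?_
          rwa [uIcc_of_le ht.1]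
        -- The subsolution inequality is integrated one-sidedly, which requires no integrability of
        -- y''.
        have hfl : (1 + t) ^ b * y' t + d * y t - y' 0 ≤ ∫ s in 0..t, (1 + s) ^ b * y s := by
          have := intervalIntegral.sub_le_integral_of_hasDeriv_right_of_le
            (g := fun s => (1 + s) ^ b * y' s + d * y s)
            (g' := fun s => (1 * b * (1 + s) ^ (b - 1)) * y' s + (1 + s) ^ b * y'' s + d * y' s)
            (φ := fun s => (1 + s) ^ b * y s) ht.1
            (((hw.mul hy'c).add (continuousOn_const.mul hyc)).mono hsubt)
            (fun s hs => ?_) (hc2.integrableOn_Icc) (fun s hs => ?_)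
          · simpa [hy0] using this
          · have h0 : 0 < 1 + s := by linarith [hs.1]
            have hs' : s ∈ Icc 0 τ := hsubt ⟨hs.1.le, hs.2.le⟩
            exact ((((((hasDerivAt_id s).const_add 1).rpow_const (Or.inl h0.ne')).mul
              (hy' s hs')).add ((hy s hs').const_mul d))).hasDerivWithinAt
          · have h0 : 0 < 1 + s := by linarith [hs.1]
            have h1 := hsub s (hsubt ⟨hs.1.le, hs.2.le⟩)
            have h2 := mul_le_mul_of_nonneg_left h1 (Real.rpow_pos_of_pos h0 b).le
            refine le_trans (le_of_eq ?_) h2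
            have h3 : (1 + s) ^ (b - 1) = (1 + s) ^ b / (1 + s) := Real.rpow_sub_one h0.ne' b
            have h4 : d = (1 + s) ^ b * (d / (1 + s)) := by
              rcases h.weights with hd | hb
              · simp [hd]
              · rw [hb, Real.rpow_one]; field_simp
            rw [h3]
            linear_combination y' s * h4
        have hint : ∫ s in 0..t, (1 + s) ^ b * (H s - y s) =
            (∫ s in 0..t, (1 + s) ^ b * H s) - ∫ s in 0..t, (1 + s) ^ b * y s := by
          rw [← intervalIntegral.integral_sub hI1 hI2]
          simp only [mul_sub]
        have := h.flux t ht
        rw [hint]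
        linarith }
  intro t ht
  linarith [(hB.nonneg_and_flux_ge zero_le_one (by linarith) t ht).1]

end MomentBound

end DampedWave

/-! ### Exponential growth of the moment against e^t-type eigenfunctions -/

namespace DampedWave

namespace MomentBound

variable {b d e q τ : ℝ} {H H₁ : ℝ → ℝ}

/-- With m = μ/2 the substitution y = (1+t)^{-m} w turns y'' + μ/(1+t) y' = y into w'' = (1 + (m² -
m)/(1+t)²) w. The hypothesis `hk` says that w = e^t (1 + k/(2+t)) - (1 + k/2) e^{-t}, which vanishes
at 0, is a subsolution. -/
theorem ge_exp_of_profile (h : MomentBound b d 1 q τ H H₁) (hq : 0 < q) {k : ℝ} (hk0 : 0 ≤ k)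
    (hk2 : k ≤ 2)
    (hk : ∀ t : ℝ, 0 ≤ t → Real.exp t * (2 * k / (2 + t) ^ 3 - 2 * k / (2 + t) ^ 2) ≤
      (((b + d) / 2) ^ 2 - (b + d) / 2) / (1 + t) ^ 2 *
        (Real.exp t * (1 + k / (2 + t)) - (1 + k / 2) * Real.exp (-t))) {t : ℝ}
    (ht1 : 1 ≤ t) (ht : t ≤ τ) :
    q / 8 * (1 + t) ^ (-((b + d) / 2)) * Real.exp t ≤ H t := by
  set m := (b + d) / 2 with hm
  have hbd : b + d = 2 * m := by rw [hm]; ring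
  set w : ℝ → ℝ := fun t => Real.exp t * (1 + k / (2 + t)) - (1 + k / 2) * Real.exp (-t) with hw
  set w' : ℝ → ℝ := fun t => Real.exp t * (1 + k / (2 + t) - k / (2 + t) ^ 2)
    + (1 + k / 2) * Real.exp (-t) with hw'
  set w'' : ℝ → ℝ := fun t => Real.exp t * (1 + k / (2 + t) - 2 * k / (2 + t) ^ 2
    + 2 * k / (2 + t) ^ 3) - (1 + k / 2) * Real.exp (-t) with hw''
  have dneg : ∀ t : ℝ, HasDerivAt (fun s => Real.exp (-s)) (-Real.exp (-t)) t := fun t => by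
    simpa using (hasDerivAt_neg t).exp
  have dinv : ∀ t : ℝ, 0 ≤ t → HasDerivAt (fun s => k / (2 + s)) (-(k / (2 + t) ^ 2)) t :=
    fun t ht => by
      have := ((hasDerivAt_const t k).div ((hasDerivAt_id t).const_add 2)
        (by simp only [id_eq]; linarith))
      refine this.congr_deriv ?_
      simp only [id_eq]; ring
  have dinv2 : ∀ t : ℝ, 0 ≤ t → HasDerivAt (fun s => k / (2 + s) ^ 2) (-(2 * k / (2 + t) ^ 3)) t :=
    fun t ht => by
      have := ((hasDerivAt_const t k).div (((hasDerivAt_id t).const_add 2).pow 2)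
        (pow_ne_zero 2 (by simp only [id_eq]; linarith)))
      refine this.congr_deriv ?_
      have : (2 + t) ≠ 0 := by linarith
      simp only [id_eq, Pi.pow_apply]; field_simp; ring
  have hdw : ∀ t : ℝ, 0 ≤ t → HasDerivAt w (w' t) t := fun t ht => by
    refine (((Real.hasDerivAt_exp t).mul ((dinv t ht).const_add 1)).sub
      ((dneg t).const_mul (1 + k / 2))).congr_deriv ?_
    simp only [hw']; ring
  have hdw' : ∀ t : ℝ, 0 ≤ t → HasDerivAt w' (w'' t) t := fun t ht => by
    refine (((Real.hasDerivAt_exp t).mul (((dinv t ht).const_add 1).sub (dinv2 t ht))).add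
      ((dneg t).const_mul (1 + k / 2))).congr_deriv ?_
    simp only [hw'']; simp only [Pi.sub_apply]; ring
  have dpow : ∀ t : ℝ, 0 ≤ t → HasDerivAt (fun s : ℝ => (1 + s) ^ (-m))
      (-(m / (1 + t)) * (1 + t) ^ (-m)) t := fun t ht => by
    have h0 : (1 + t) ≠ 0 := by linarith
    refine (((hasDerivAt_id t).const_add 1).rpow_const (p := -m) (Or.inl h0)).congr_deriv ?_
    simp only [id_eq]
    rw [Real.rpow_sub_one h0]
    ring
  have dm : ∀ t : ℝ, 0 ≤ t → HasDerivAt (fun s => m / (1 + s)) (-(m / (1 + t) ^ 2)) t :=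
    fun t ht => by
      have := ((hasDerivAt_const t m).div ((hasDerivAt_id t).const_add 1)
        (by simp only [id_eq]; linarith))
      refine this.congr_deriv ?_
      simp only [id_eq]; ring
  have key := h.ge_of_subsolution
    (y := fun t => q / 4 * ((1 + t) ^ (-m) * w t))
    (y' := fun t => q / 4 * ((1 + t) ^ (-m) * (w' t - m / (1 + t) * w t)))
    (y'' := fun t => q / 4 * ((1 + t) ^ (-m) * (w'' t - 2 * (m / (1 + t)) * w' t +
      (m ^ 2 + m) / (1 + t) ^ 2 * w t)))
    (fun t ht => by
      refine (((dpow t ht.1).mul (hdw t ht.1)).const_mul (q / 4)).congr_deriv ?_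
      ring)
    (fun t ht => by
      refine (((dpow t ht.1).mul ((hdw' t ht.1).sub ((dm t ht.1).mul (hdw t ht.1)))).const_mul
        (q / 4)).congr_deriv ?_
      have h0 : (1 + t) ≠ 0 := by linarith [ht.1]
      simp only [Pi.sub_apply, Pi.mul_apply]
      field_simp
      ring)
    (fun t ht => by
      have h0 : 0 < 1 + t := by linarith [ht.1]
      have h1 : w'' t ≤ (1 + (m ^ 2 - m) / (1 + t) ^ 2) * w t := by
        have := hk t ht.1
        simp only [hw, hw''] at this ⊢
        linarith
      have h2 : 0 ≤ q / 4 * (1 + t) ^ (-m) := by positivity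
      have h3 := mul_le_mul_of_nonneg_left h1 h2
      rw [hbd]
      refine le_trans (le_of_eq ?_) (sub_le_iff_le_add.2 (h3.trans_eq (c :=
        q / 4 * ((1 + t) ^ (-m) * w t) +
        q / 4 * (1 + t) ^ (-m) * ((m ^ 2 - m) / (1 + t) ^ 2 * w t)) (by ring)))
      field_simp
      ring)
    (by simp [hw])
    -- The factor q/4 suffices because w'(0) = 2 + 3k/4 < 4 for k ≤ 2.
    (by
      simp only [hw, hw']
      norm_num
      nlinarith)
    t ⟨by linarith, ht⟩
  refine le_trans ?_ key
  have h0 : 0 < 1 + t := by linarith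
  have hw1 : Real.exp t / 2 ≤ w t := by
    have h2 : 0 ≤ k / (2 + t) := div_nonneg hk0 (by linarith)
    have h3 : Real.exp t * Real.exp (-t) = 1 := by rw [← Real.exp_add]; simp
    have h4 : 2 ≤ Real.exp t := by linarith [Real.add_one_le_exp t]
    have h5 := Real.exp_pos (-t)
    have h6 : Real.exp t * 1 ≤ Real.exp t * (1 + k / (2 + t)) := by gcongr; linarith
    have h7 : (1 + k / 2) * Real.exp (-t) ≤ 2 * Real.exp (-t) := by gcongr; linarith
    have h8 : 4 * Real.exp (-t) ≤ Real.exp t := by nlinarith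
    simp only [hw]
    linarith
  have h9 : 0 ≤ q / 4 * (1 + t) ^ (-m) := by positivity
  have := mul_le_mul_of_nonneg_left hw1 h9
  linarith

/-- Exponential growth of a moment driven by `H'' + μ/(1+t) H' ≥ H`. -/
theorem ge_exp (h : MomentBound b d 1 q τ H H₁) (hq : 0 < q) {t : ℝ} (ht1 : 1 ≤ t) (ht : t ≤ τ) :
    q / 8 * (1 + t) ^ (-((b + d) / 2)) * Real.exp t ≤ H t := by
  -- For m² - m ≥ 0 the profile 2 sinh t is already a subsolution. Otherwise m² - m ≥ -1/4, and the
  -- correction with k = 2 compensates the negative potential: after the e^{-s} term is dropped, 2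
  -- is the least k that works at s = 0 in the extreme case -1/4.
  rcases le_total 0 (((b + d) / 2) ^ 2 - (b + d) / 2) with hκ | hκ
  · refine h.ge_exp_of_profile hq (k := 0) le_rfl (by norm_num) (fun s hs => ?_) ht1 ht
    have h1 : Real.exp (-s) ≤ Real.exp s := Real.exp_le_exp.2 (by linarith)
    simp only [mul_zero, zero_div, sub_self, add_zero, mul_one, one_mul]
    exact mul_nonneg (by positivity) (by linarith)
  · refine h.ge_exp_of_profile hq (k := 2) (by norm_num) le_rfl (fun s hs => ?_) ht1 ht
    set κ := ((b + d) / 2) ^ 2 - (b + d) / 2 with hκdef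
    have hκ4 : -(1 / 4) ≤ κ := by rw [hκdef]; nlinarith [sq_nonneg ((b + d) / 2 - 1 / 2)]
    have h0 : 0 < 1 + s := by linarith
    have hE := Real.exp_pos s
    have h1 : κ / (1 + s) ^ 2 * (Real.exp s * (1 + 2 / (2 + s))) ≤
        κ / (1 + s) ^ 2 * (Real.exp s * (1 + 2 / (2 + s)) - (1 + 2 / 2) * Real.exp (-s)) := by
      have h2 : κ / (1 + s) ^ 2 ≤ 0 := div_nonpos_of_nonpos_of_nonneg hκ (by positivity)
      have h3 := Real.exp_pos (-s)
      nlinarith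
    refine le_trans ?_ h1
    have h4 : 2 * 2 / (2 + s) ^ 3 - 2 * 2 / (2 + s) ^ 2 ≤ κ / (1 + s) ^ 2 * (1 + 2 / (2 + s)) := by
      have h5 : -(1 / 4) / (1 + s) ^ 2 * (1 + 2 / (2 + s)) ≤
          κ / (1 + s) ^ 2 * (1 + 2 / (2 + s)) := by gcongr
      refine le_trans ?_ h5
      have h6 : -(1 / 4) / (1 + s) ^ 2 * (1 + 2 / (2 + s)) -
          (2 * 2 / (2 + s) ^ 3 - 2 * 2 / (2 + s) ^ 2) =
          (16 * (1 + s) ^ 3 - (4 + s) * (2 + s) ^ 2) / (4 * (1 + s) ^ 2 * (2 + s) ^ 3) := by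
        field_simp
        ring
      have h7 : 0 ≤ (16 * (1 + s) ^ 3 - (4 + s) * (2 + s) ^ 2) /
          (4 * (1 + s) ^ 2 * (2 + s) ^ 3) := by
        refine div_nonneg ?_ (by positivity)
        nlinarith [pow_nonneg hs 2, pow_nonneg hs 3]
      linarith
    calc _ ≤ Real.exp s * (κ / (1 + s) ^ 2 * (1 + 2 / (2 + s))) := by gcongr
      _ = _ := by ring

end MomentBound

/-! ### Superlinear self-forcing -/

/-- A function on `[σ,2σ]` that is bounded below by `L` and superlinearly forces itself through
Duhamel's formula exists only if the force is bounded in terms of the exponent. -/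
theorem selfForcing_lt {F N : ℝ → ℝ} {σ c B L p : ℝ} (hp : 1 < p) (hσ : 0 < σ) (hc : 0 < c)
    (hB : 0 < B) (hL : 0 < L) (hF : ∀ t ∈ Icc σ (2 * σ), L ≤ F t)
    (hN : ∀ t ∈ Icc σ (2 * σ), B * F t ^ p ≤ N t)
    (hforce : ∀ a t ν : ℝ, σ ≤ a → a ≤ t → t ≤ 2 * σ → 0 ≤ ν → (∀ s ∈ Icc a t, ν ≤ N s) →
      c * ν * (t - a) ^ 2 ≤ F t) :
    c * B * σ ^ 2 * L ^ (p - 1) < 4 * 4 ^ (1 / (p - 1)) := by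
  by_contra! hM
  -- D^{p-1} = 4 makes D^p = 4 D: the growth of the p-th power exactly offsets the factor 1/4 lost
  -- in (t-a)² when the interval is halved.
  set D : ℝ := 4 ^ (1 / (p - 1)) with hD
  have hD1 : 1 < D := Real.one_lt_rpow (by norm_num) (by apply div_pos one_pos; linarith)
  have hD0 : 0 < D := by linarith
  have hDp : D ^ p = D * 4 := by
    have : D ^ (p - 1) = 4 := by
      rw [hD, ← Real.rpow_mul (by norm_num), one_div_mul_cancel (by linarith), Real.rpow_one]
    rw [← this, ← Real.rpow_one_add' hD0.le (by linarith)]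
    congr 1; ring
  have hLp : L ^ p = L * L ^ (p - 1) := by
    rw [← Real.rpow_one_add' hL.le (by linarith)]
    congr 1; ring
  have key : ∀ k : ℕ, ∀ t ∈ Icc (2 * σ - σ / 2 ^ k) (2 * σ), L * D ^ k ≤ F t := by
    intro k
    induction k with
    | zero =>
      intro t ht
      simpa using hF t ⟨by have := ht.1; simp at this; linarith, ht.2⟩
    | succ k ih =>
      intro t ht
      have e1 : σ / 2 ^ (k + 1) = σ / 2 ^ k / 2 := by rw [pow_succ]; field_simp
      have e2 : 0 < σ / 2 ^ k := by positivity
      have e3 : σ / 2 ^ k ≤ σ := div_le_self hσ.le (one_le_pow₀ (by norm_num))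
      have ht1 := ht.1
      rw [e1] at ht1
      have h1 := hforce (2 * σ - σ / 2 ^ k) t (B * (L * D ^ k) ^ p) (by linarith) (by linarith)
        ht.2 (by positivity) (fun s hs => by
          refine le_trans ?_ (hN s ⟨by linarith [hs.1], hs.2.trans ht.2⟩)
          have := ih s ⟨hs.1, hs.2.trans ht.2⟩
          gcongr)
      refine le_trans ?_ h1
      have h2 : (σ / 2 ^ k / 2) ^ 2 ≤ (t - (2 * σ - σ / 2 ^ k)) ^ 2 :=
        pow_le_pow_left₀ (by positivity) (by linarith) 2
      have h3 : c * (B * (L * D ^ k) ^ p) * (σ / 2 ^ k / 2) ^ 2 ≤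
          c * (B * (L * D ^ k) ^ p) * (t - (2 * σ - σ / 2 ^ k)) ^ 2 := by gcongr
      refine le_trans ?_ h3
      have e4 : (L * D ^ k) ^ p = L * L ^ (p - 1) * (D * 4) ^ k := by
        rw [Real.mul_rpow hL.le (by positivity), ← Real.rpow_natCast D k, ← Real.rpow_mul hD0.le,
          mul_comm (k : ℝ) p, Real.rpow_mul hD0.le, hDp, hLp, Real.rpow_natCast]
      have e5 : c * (B * (L * D ^ k) ^ p) * (σ / 2 ^ k / 2) ^ 2 =
          L * D ^ k * ((c * B * σ ^ 2 * L ^ (p - 1)) / 4) := by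
        rw [e4, mul_pow D 4 k,
          show (4 : ℝ) ^ k = (2 ^ k) ^ 2 by rw [← pow_mul, mul_comm, pow_mul]; norm_num]
        field_simp
        norm_num
      rw [e5, pow_succ, ← mul_assoc]
      have h6 : 0 ≤ L * D ^ k := by positivity
      exact mul_le_mul_of_nonneg_left (by linarith) h6
  -- The endpoint 2σ lies in every interval of the iteration, so F(2σ) would exceed L D^k for all k.
  obtain ⟨k, hk⟩ := pow_unbounded_of_one_lt (F (2 * σ) / L) hD1
  have h1 := key k (2 * σ) ⟨by have : 0 < σ / 2 ^ k := by positivity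
                               linarith, le_rfl⟩
  rw [div_lt_iff₀ hL] at hk
  linarith

end DampedWave

/-! ### Radial eigenfunctions of the Laplacian on ℝⁿ and their cutoffs -/

namespace DampedWave

variable {n : ℕ}

/-- The radial solution of `Δφ = e φ`, `φ(0) = 1`. -/
noncomputable def radialProfile (n : ℕ) (e : ℝ) (x : Space n) : ℝ := besselSeries n (e * ‖x‖ ^ 2)

theorem contDiff_radialProfile (hn : 1 ≤ n) (e : ℝ) : ContDiff ℝ ∞ (radialProfile n e) :=
  (contDiff_besselSeries hn).comp (contDiff_const.mul (contDiff_norm_sq ℝ))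

theorem one_le_radialProfile (hn : 1 ≤ n) {e : ℝ} (he : 0 ≤ e) (x : Space n) :
    1 ≤ radialProfile n e x := one_le_besselSeries hn (by positivity)

theorem radialProfile_zero (x : Space n) : radialProfile n 0 x = 1 := by
  simp [radialProfile, besselSeries_zero]

theorem gradient_apply (Ψ : Space n → ℝ) (x : Space n) (i : Fin n) :
    gradient Ψ x i = fderiv ℝ Ψ x (EuclideanSpace.single i 1) := by
  rw [← inner_gradient_left, EuclideanSpace.inner_single_right]
  simp

theorem hasFDerivAt_besselSeries_norm_sq {k : ℕ} (hk : 1 ≤ k) (e : ℝ) (x : Space n) :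
    HasFDerivAt (fun y : Space n => besselSeries k (e * ‖y‖ ^ 2))
      ((besselSeries (k + 2) (e * ‖x‖ ^ 2) / k * e) • innerSL ℝ x) x := by
  have h1 := ((hasFDerivAt_id x).norm_sq).const_mul e
  have h2 := (hasDerivAt_besselSeries hk (e * ‖x‖ ^ 2)).comp_hasFDerivAt x h1
  refine h2.congr_fderiv ?_
  ext v
  simp
  have : (k : ℝ) ≠ 0 := by positivity
  field_simp

theorem gradient_radialProfile_apply (hn : 1 ≤ n) (e : ℝ) (x : Space n) (i : Fin n) :
    gradient (radialProfile n e) x i = besselSeries (n + 2) (e * ‖x‖ ^ 2) / n * e * x i := by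
  rw [gradient_apply]
  unfold radialProfile
  rw [(hasFDerivAt_besselSeries_norm_sq hn e x).fderiv]
  simp [EuclideanSpace.inner_single_right]

theorem gradient_gradient_radialProfile_apply (hn : 1 ≤ n) (e : ℝ) (x : Space n) (i : Fin n) :
    gradient (fun y => gradient (radialProfile n e) y i) x i
      = (e * (e * x i ^ 2)) * (besselSeries (n + 2 + 2) (e * ‖x‖ ^ 2) / (n * (n + 2)))
        + e * (besselSeries (n + 2) (e * ‖x‖ ^ 2) / n) := by
  rw [gradient_apply]
  simp_rw [gradient_radialProfile_apply hn]
  have h1 := (hasFDerivAt_besselSeries_norm_sq (show 1 ≤ n + 2 by omega) e x)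
  have h2 : HasFDerivAt (fun y : Space n => y i) (EuclideanSpace.proj i : Space n →L[ℝ] ℝ) x :=
    (EuclideanSpace.proj (𝕜 := ℝ) i : Space n →L[ℝ] ℝ).hasFDerivAt
  have h3 := ((h1.mul_const ((n : ℝ)⁻¹ * e)).mul h2)
  have h4 : (fun y : Space n => besselSeries (n + 2) (e * ‖y‖ ^ 2) / n * e * y i) =
    ((fun y : Space n => besselSeries (n + 2) (e * ‖y‖ ^ 2) * ((n : ℝ)⁻¹ * e)) *
      fun y : Space n => y i) := by
    ext y; simp only [Pi.mul_apply]; ring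
  rw [h4, h3.fderiv]
  have : (n : ℝ) ≠ 0 := by positivity
  simp [EuclideanSpace.inner_single_right]
  field_simp
  ring

/-- Summing the second derivatives turns x_i² into |x|² and leaves `besselSeries_ode` at z = e|x|².
-/
theorem laplacian_radialProfile (hn : 1 ≤ n) (e : ℝ) (x : Space n) :
    ∑ i, gradient (fun y => gradient (radialProfile n e) y i) x i = e * radialProfile n e x := by
  simp_rw [gradient_gradient_radialProfile_apply hn]
  rw [Finset.sum_add_distrib, ← Finset.sum_mul, ← Finset.mul_sum, ← Finset.mul_sum,
    ← EuclideanSpace.real_norm_sq_eq]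
  have hn' : (n : ℝ) ≠ 0 := by positivity
  simp only [Finset.sum_const, Finset.card_univ, Fintype.card_fin, nsmul_eq_mul]
  rw [radialProfile, ← besselSeries_ode hn]
  field_simp

theorem contDiff_gradient_apply {Ψ : Space n → ℝ} (hΨ : ContDiff ℝ ∞ Ψ) (i : Fin n) :
    ContDiff ℝ ∞ fun x => gradient Ψ x i := by
  simp_rw [gradient_apply]
  exact (hΨ.fderiv_right (m := ∞) (by simp)).clm_apply contDiff_const

theorem hasCompactSupport_gradient_apply {Ψ : Space n → ℝ} (hΨ : HasCompactSupport Ψ)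
    (i : Fin n) : HasCompactSupport fun x => gradient Ψ x i := by
  simp_rw [gradient_apply]
  exact (hΨ.fderiv ℝ).comp_left (g := fun L : Space n →L[ℝ] ℝ => L (EuclideanSpace.single i 1))
    (by simp)

theorem continuous_gradient {Ψ : Space n → ℝ} (hΨ : ContDiff ℝ ∞ Ψ) :
    Continuous (gradient Ψ) := by
  unfold gradient
  exact (LinearIsometryEquiv.continuous _).comp (hΨ.continuous_fderiv (by simp))

theorem hasCompactSupport_gradient {Ψ : Space n → ℝ} (hΨ : HasCompactSupport Ψ) :
    HasCompactSupport (gradient Ψ) :=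
  (hΨ.fderiv ℝ).comp_left (g := (InnerProductSpace.toDual ℝ (Space n)).symm) (by simp)

/-- The weak gradient is tested with each ∂ᵢΨ, and of the resulting vector identity only the i-th
component is kept; the sum over i is Green's formula. -/
theorem integral_inner_gradient {w : Space n → ℝ} {G : Space n → Space n} (hw : MemLp w 2 volume)
    (hG : MemLp G 2 volume) (hwG : IsWeakGradient w G) {Ψ : Space n → ℝ} (hΨ : ContDiff ℝ ∞ Ψ)
    (hΨc : HasCompactSupport Ψ) :
    ∫ x, inner ℝ (G x) (gradient Ψ x)
      = -∫ x, w x * ∑ i, gradient (fun y => gradient Ψ y i) x i := by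
  have hψ : ∀ i, MemLp (fun x => gradient Ψ x i) 2 (volume : Measure (Space n)) := fun i =>
    (contDiff_gradient_apply hΨ i).continuous.memLp_of_hasCompactSupport
      (hasCompactSupport_gradient_apply hΨc i)
  have hψψ : ∀ i, MemLp (gradient (fun y => gradient Ψ y i)) 2 (volume : Measure (Space n)) :=
    fun i => (continuous_gradient (contDiff_gradient_apply hΨ i)).memLp_of_hasCompactSupport
      (hasCompactSupport_gradient (hasCompactSupport_gradient_apply hΨc i))
  have hproj : ∀ (i : Fin n) {V : Space n → Space n}, MemLp V 2 volume →
      MemLp (fun x => V x i) 2 (volume : Measure (Space n)) := fun i V hV =>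
    (EuclideanSpace.proj (𝕜 := ℝ) i : Space n →L[ℝ] ℝ).comp_memLp' hV
  have hi : ∀ i, ∫ x, w x * gradient (fun y => gradient Ψ y i) x i
      = -∫ x, gradient Ψ x i * G x i := by
    intro i
    have h1 := congrArg (EuclideanSpace.proj (𝕜 := ℝ) i : Space n →L[ℝ] ℝ)
      (hwG _ (contDiff_gradient_apply hΨ i) (hasCompactSupport_gradient_apply hΨc i))
    have i1 : Integrable (fun x => w x • gradient (fun y => gradient Ψ y i) x) volume :=
      memLp_one_iff_integrable.1 ((hψψ i).smul hw)
    have i2 : Integrable (fun x => gradient Ψ x i • G x) volume :=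
      memLp_one_iff_integrable.1 (hG.smul (hψ i))
    rw [map_neg, ← ContinuousLinearMap.integral_comp_comm _ i1,
      ← ContinuousLinearMap.integral_comp_comm _ i2] at h1
    simpa using h1
  simp_rw [Finset.mul_sum]
  rw [integral_finsetSum]
  · rw [Finset.sum_congr rfl fun i _ => hi i, Finset.sum_neg_distrib, neg_neg,
      ← integral_finsetSum]
    · refine integral_congr_ae (Eventually.of_forall fun x => ?_)
      change inner ℝ (G x) (gradient Ψ x) = _
      rw [PiLp.inner_apply]
      simp [mul_comm]
    · exact fun i _ => (hψ i).integrable_mul (hproj i hG)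
  · exact fun i _ => hw.integrable_mul (hproj i (hψψ i))

/-- A smooth cutoff of `radialProfile n e` that agrees with it on the ball of radius `ρ`. -/
theorem exists_cutoff_radialProfile (hn : 1 ≤ n) {e : ℝ} (he : 0 ≤ e) {ρ : ℝ} (hρ : 0 < ρ) :
    ∃ Ψ : Space n → ℝ, ContDiff ℝ ∞ Ψ ∧ HasCompactSupport Ψ ∧ (∀ x, 0 ≤ Ψ x) ∧
      (∀ x, ‖x‖ < ρ → Ψ x = radialProfile n e x) ∧
      ∀ x, ‖x‖ < ρ → ∑ i, gradient (fun y => gradient Ψ y i) x i = e * Ψ x := by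
  let χ : ContDiffBump (0 : Space n) := ⟨ρ, ρ + 1, hρ, by linarith⟩
  have hEq : ∀ x : Space n, ‖x‖ < ρ → χ x * radialProfile n e x = radialProfile n e x := by
    intro x hx
    rw [χ.one_of_mem_closedBall (by simpa [χ] using hx.le), one_mul]
  refine ⟨fun x => χ x * radialProfile n e x, χ.contDiff.mul (contDiff_radialProfile hn e),
    χ.hasCompactSupport.mul_right, fun x => mul_nonneg χ.nonneg
      (zero_le_one.trans (one_le_radialProfile hn he x)), hEq, fun x hx => ?_⟩
  have hev : ∀ x : Space n, ‖x‖ < ρ →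
      (fun x => χ x * radialProfile n e x) =ᶠ[𝓝 x] radialProfile n e := fun x hx => by
    filter_upwards [(isOpen_lt continuous_norm continuous_const).mem_nhds hx] with y hy
    exact hEq y hy
  have hev2 : ∀ i, (fun y => gradient (fun x => χ x * radialProfile n e x) y i) =ᶠ[𝓝 x]
      fun y => gradient (radialProfile n e) y i := fun i => by
    filter_upwards [(isOpen_lt continuous_norm continuous_const).mem_nhds hx] with y hy
    rw [(hev y hy).gradient_eq]
  simp_rw [fun i => (hev2 i).gradient_eq]
  rw [laplacian_radialProfile hn, hEq x hx]

end DampedWave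

/-! ### From the weak formulation to moments -/

namespace DampedWave

variable {n : ℕ}

theorem integrable_inner_of_memLp {G V : Space n → Space n} (hG : MemLp G 2 volume)
    (hV : MemLp V 2 volume) : Integrable fun x => inner ℝ (G x) (V x) := by
  refine (L2.integrable_inner (𝕜 := ℝ) hG.toLp hV.toLp).congr ?_
  filter_upwards [hG.coeFn_toLp, hV.coeFn_toLp] with x h1 h2
  rw [h1, h2]

/-- A smooth compactly supported extension of a function that is smooth on `(-1,∞)`, from a
neighbourhood of `[0,t]`, with support in `(-1,T)`. -/
theorem exists_cutoff_time {θ : ℝ → ℝ} (hθ : ContDiffOn ℝ ∞ θ (Ioi (-1))) {t T : ℝ} (ht0 : 0 ≤ t)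
    (htT : t < T) : ∃ ζ : ℝ → ℝ, ContDiff ℝ ∞ ζ ∧ HasCompactSupport ζ ∧ tsupport ζ ⊆ Iio T ∧
      ∀ s ∈ Icc 0 t, ζ =ᶠ[𝓝 s] θ := by
  obtain ⟨δ, hδ0, hδ1, hδT⟩ : ∃ δ : ℝ, 0 < δ ∧ 2 * δ < 1 ∧ t + 2 * δ < T := by
    refine ⟨min (1 / 4) ((T - t) / 4), lt_min (by norm_num) (by linarith), ?_, ?_⟩
    · linarith [min_le_left (1 / 4) ((T - t) / 4)]
    · linarith [min_le_right (1 / 4) ((T - t) / 4)]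
  -- The bump is 1 on a δ-neighbourhood of [0,t] and is supported in [-2δ, t+2δ], which lies in
  -- (-1,T).
  let η : ContDiffBump (t / 2) := ⟨t / 2 + δ, t / 2 + 2 * δ, by positivity, by linarith⟩
  have hts : tsupport η = Metric.closedBall (t / 2) (t / 2 + 2 * δ) := η.tsupport_eq
  refine ⟨fun s => η s * θ s, ?_, η.hasCompactSupport.mul_right, ?_, ?_⟩
  · rw [contDiff_iff_contDiffAt]
    intro s
    by_cases hs : -1 < s
    · exact η.contDiff.contDiffAt.mul (hθ.contDiffAt (Ioi_mem_nhds hs))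
    · have hs' : s ∉ tsupport η := by
        rw [hts, Metric.mem_closedBall, Real.dist_eq]
        intro h
        have := (abs_le.1 h).1
        linarith
      have : (fun s => η s * θ s) =ᶠ[𝓝 s] fun _ => 0 := by
        filter_upwards [(isClosed_tsupport η).isOpen_compl.mem_nhds hs'] with r hr
        rw [image_eq_zero_of_notMem_tsupport hr, zero_mul]
      exact contDiffAt_const.congr_of_eventuallyEq this
  · refine (tsupport_mul_subset_left (f := fun s => η s) (g := θ)).trans ?_
    rw [hts]
    intro s hs
    rw [Metric.mem_closedBall, Real.dist_eq] at hs
    have := (abs_le.1 hs).2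
    simp only [mem_Iio]
    linarith
  · intro s hs
    have : Metric.ball (t / 2) (t / 2 + δ) ∈ 𝓝 s := Metric.isOpen_ball.mem_nhds (by
      rw [Metric.mem_ball, Real.dist_eq, abs_lt]
      constructor <;> linarith [hs.1, hs.2])
    filter_upwards [this] with r hr
    rw [η.one_of_mem_closedBall (Metric.ball_subset_closedBall hr), one_mul]

variable {μ p ε T R : ℝ} {f g : Space n → ℝ}
  {u ut : ℝ → Lp ℝ 2 (volume : Measure (Space n))}
  {Du : ℝ → Lp (Space n) 2 (volume : Measure (Space n))}

/-- The weak formulation tested with `θ(s) Ψ(x)`, where `ΔΨ = e Ψ` on the support of `u`. -/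
theorem weighted_moment_identity
    (hgrad : ∀ t ∈ Ico 0 T, IsWeakGradient (u t) (Du t))
    (hweak : ∀ φ : Space n × ℝ → ℝ, ContDiff ℝ ∞ φ → HasCompactSupport φ →
      tsupport φ ⊆ {z | z.2 < T} → ∀ t ∈ Ico 0 T,
        (∫ x, ut t x * φ (x, t)) - (∫ x, ε * g x * φ (x, 0))
          + (∫ s in 0..t, ∫ x, (-(ut s x * deriv (fun τ => φ (x, τ)) s)
              + inner ℝ (Du s x) (gradient (fun y => φ (y, s)) x)))
          + (∫ s in 0..t, ∫ x, μ / (1 + s) * ut s x * φ (x, s))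
        = ∫ s in 0..t, ∫ x, |u s x| ^ p * φ (x, s))
    (hcone : SupportedInCone R T u) {e ρ : ℝ} {Ψ : Space n → ℝ} (hΨ : ContDiff ℝ ∞ Ψ)
    (hΨc : HasCompactSupport Ψ)
    (hlap : ∀ x, ‖x‖ < ρ → ∑ i, gradient (fun y => gradient Ψ y i) x i = e * Ψ x)
    {θ : ℝ → ℝ} (hθ : ContDiffOn ℝ ∞ θ (Ioi (-1))) {t : ℝ} (ht : t ∈ Ico 0 T)
    (hρ : t + R < ρ) :
    θ t * (∫ x, ut t x * Ψ x) - θ 0 * (∫ x, ε * g x * Ψ x)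
      + (∫ s in 0..t, (-(deriv θ s * ∫ x, ut s x * Ψ x) - e * (θ s * ∫ x, u s x * Ψ x)))
      + (∫ s in 0..t, μ / (1 + s) * θ s * ∫ x, ut s x * Ψ x)
      = ∫ s in 0..t, θ s * ∫ x, |u s x| ^ p * Ψ x := by
  obtain ⟨ζ, hζ, hζc, hζT, hζθ⟩ := exists_cutoff_time hθ ht.1 ht.2
  have hval : ∀ s ∈ Icc 0 t, ζ s = θ s := fun s hs => (hζθ s hs).eq_of_nhds
  have hder : ∀ s ∈ Icc 0 t, deriv ζ s = deriv θ s := fun s hs => (hζθ s hs).deriv_eq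
  have hΨ2 : MemLp Ψ 2 (volume : Measure (Space n)) :=
    hΨ.continuous.memLp_of_hasCompactSupport hΨc
  have hdΨ2 : MemLp (gradient Ψ) 2 (volume : Measure (Space n)) :=
    (continuous_gradient hΨ).memLp_of_hasCompactSupport (hasCompactSupport_gradient hΨc)
  have hsupp : tsupport (fun z : Space n × ℝ => Ψ z.1 * ζ z.2) ⊆ tsupport Ψ ×ˢ tsupport ζ := by
    refine closure_minimal ?_ ((isClosed_tsupport _).prod (isClosed_tsupport _))
    intro z hz
    rw [Function.mem_support] at hz
    exact ⟨subset_tsupport _ (left_ne_zero_of_mul hz), subset_tsupport _ (right_ne_zero_of_mul hz)⟩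
  have h := hweak (fun z => Ψ z.1 * ζ z.2)
    ((hΨ.comp contDiff_fst).mul (hζ.comp contDiff_snd))
    ((hΨc.isCompact.prod hζc.isCompact).of_isClosed_subset (isClosed_tsupport _) hsupp)
    (fun z hz => hζT (hsupp hz).2) t ht
  have e0 : ∀ s ∈ Icc 0 t, ∫ x, ut s x * (Ψ x * ζ s) = θ s * ∫ x, ut s x * Ψ x := by
    intro s hs
    rw [← integral_const_mul, hval s hs]
    refine integral_congr_ae (Eventually.of_forall fun x => ?_)
    simp only; ring
  have e1 : ∫ x, ε * g x * (Ψ x * ζ 0) = θ 0 * ∫ x, ε * g x * Ψ x := by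
    rw [← integral_const_mul, hval 0 ⟨le_rfl, ht.1⟩]
    refine integral_congr_ae (Eventually.of_forall fun x => ?_)
    simp only; ring
  have e2 : ∀ s ∈ Icc 0 t, ∫ x, μ / (1 + s) * ut s x * (Ψ x * ζ s)
      = μ / (1 + s) * θ s * ∫ x, ut s x * Ψ x := by
    intro s hs
    rw [← integral_const_mul, hval s hs]
    refine integral_congr_ae (Eventually.of_forall fun x => ?_)
    simp only; ring
  have e3 : ∀ s ∈ Icc 0 t, ∫ x, |u s x| ^ p * (Ψ x * ζ s) = θ s * ∫ x, |u s x| ^ p * Ψ x := by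
    intro s hs
    rw [← integral_const_mul, hval s hs]
    refine integral_congr_ae (Eventually.of_forall fun x => ?_)
    simp only; ring
  have e4 : ∀ s ∈ Icc 0 t, ∫ x, (-(ut s x * deriv (fun τ => Ψ x * ζ τ) s)
      + inner ℝ (Du s x) (gradient (fun y => Ψ y * ζ s) x))
      = -(deriv θ s * ∫ x, ut s x * Ψ x) - e * (θ s * ∫ x, u s x * Ψ x) := by
    intro s hs
    have hsT : s ∈ Ico 0 T := ⟨hs.1, hs.2.trans_lt ht.2⟩
    -- Where |x| ≥ ρ the solution vanishes by the cone condition, so ΔΨ may be replaced by e Ψ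
    -- everywhere.
    have hlapu : ∫ x, inner ℝ (Du s x) (gradient Ψ x) = -(e * ∫ x, u s x * Ψ x) := by
      rw [integral_inner_gradient (Lp.memLp (u s)) (Lp.memLp (Du s)) (hgrad s hsT) hΨ hΨc,
        ← integral_const_mul]
      congr 1
      refine integral_congr_ae ?_
      filter_upwards [hcone s hsT] with x hx
      by_cases hxρ : ‖x‖ < ρ
      · rw [hlap x hxρ]; ring
      · rw [hx (by linarith [hs.2])]; ring
    have hg : ∀ x, gradient (fun y => Ψ y * ζ s) x = θ s • gradient Ψ x := by
      intro x
      have hd : DifferentiableAt ℝ Ψ x := hΨ.differentiable (by simp) x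
      rw [← hval s hs]
      refine HasGradientAt.gradient ?_
      rw [hasGradientAt_iff_hasFDerivAt]
      refine (hd.hasGradientAt.hasFDerivAt.mul_const (ζ s)).congr_fderiv ?_
      simp
    have hd : ∀ x, deriv (fun τ => Ψ x * ζ τ) s = Ψ x * deriv θ s := by
      intro x
      rw [deriv_const_mul_field, hder s hs]
    simp_rw [hg, hd, inner_smul_right]
    have i1 : Integrable (fun x => ut s x * (Ψ x * deriv θ s)) volume := by
      simp_rw [← mul_assoc]
      exact ((Lp.memLp (ut s)).integrable_mul hΨ2).mul_const _
    have i2 : Integrable (fun x => θ s * inner ℝ (Du s x) (gradient Ψ x)) volume :=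
      (integrable_inner_of_memLp (Lp.memLp (Du s)) hdΨ2).const_mul _
    rw [integral_add i1.fun_neg i2, integral_neg, integral_const_mul, hlapu]
    simp_rw [← mul_assoc]
    rw [integral_mul_const]
    ring
  have hu : uIcc 0 t = Icc 0 t := uIcc_of_le ht.1
  rw [e0 t ⟨ht.1, le_rfl⟩, e1] at h
  rw [intervalIntegral.integral_congr (fun s hs => e4 s (hu ▸ hs)),
    intervalIntegral.integral_congr (fun s hs => e2 s (hu ▸ hs)),
    intervalIntegral.integral_congr (fun s hs => e3 s (hu ▸ hs))] at h
  exact h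

/-- As a continuous linear functional on L², the moment inherits the time regularity of u. -/
theorem integral_mul_eq_inner {Ψ : Space n → ℝ} (hΨ : MemLp Ψ 2 (volume : Measure (Space n)))
    (w : Lp ℝ 2 (volume : Measure (Space n))) :
    ∫ x, w x * Ψ x = innerSL ℝ hΨ.toLp w := by
  rw [innerSL_apply_apply, L2.inner_def]
  refine integral_congr_ae ?_
  filter_upwards [hΨ.coeFn_toLp] with x hx
  rw [hx]
  simp

/-- The moment of an energy solution against a cut-off eigenfunction of the Laplacian. -/
theorem IsEnergySolution.exists_moment {b d : ℝ} (hb : 0 ≤ b) (hd : 0 ≤ d) (hbd : b + d = μ)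
    (hw : d = 0 ∨ b = 1) (hu : IsEnergySolution μ p ε f g T u) (hcone : SupportedInCone R T u)
    (hε : 0 ≤ ε) (hf2 : MemLp f 2 volume) (hg2 : MemLp g 2 volume) (hf0 : ∀ᵐ x, 0 ≤ f x)
    (hh0 : ∀ᵐ x, 0 ≤ d * f x + g x) {e τ ρ : ℝ} (hτ : τ ∈ Ico 0 T) (hρ : τ + R < ρ)
    (hRρ : R < ρ)
    {Ψ : Space n → ℝ} (hΨ : ContDiff ℝ ∞ Ψ) (hΨc : HasCompactSupport Ψ) (hΨ0 : ∀ x, 0 ≤ Ψ x)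
    (hΨ1 : ∀ x, ‖x‖ < ρ → 1 ≤ Ψ x)
    (hlap : ∀ x, ‖x‖ < ρ → ∑ i, gradient (fun y => gradient Ψ y i) x i = e * Ψ x) :
    ∃ H₁ : ℝ → ℝ, MomentBound b d e (ε * ∫ x in Metric.closedBall 0 R, (d * f x + g x)) τ
        (fun t => ∫ x, u t x * Ψ x) H₁ ∧
      (e = 0 → 0 ≤ (ε * ∫ x in Metric.closedBall 0 R, (d * f x + g x)) →
        ∀ t ∈ Icc 0 τ, (∫ s in 0..t, (1 + s) ^ b * ∫ x, |u s x| ^ p * Ψ x) ≤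
        (1 + t) ^ b * H₁ t + d * ∫ x, u t x * Ψ x) := by
  obtain ⟨ut, Du, hcu, hgrad, hcDu, hderiv, hcut, hut0, hweak⟩ := hu.weak_form
  have hΨ2 : MemLp Ψ 2 (volume : Measure (Space n)) :=
    hΨ.continuous.memLp_of_hasCompactSupport hΨc
  have hT0 : (0 : ℝ) ∈ Ico 0 T := ⟨le_rfl, hτ.1.trans_lt hτ.2⟩
  have hsubT : Icc 0 τ ⊆ Ico 0 T := fun s hs => ⟨hs.1, hs.2.trans_lt hτ.2⟩
  have hfΨ : Integrable (fun x => f x * Ψ x) volume := hf2.integrable_mul hΨ2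
  have hgΨ : Integrable (fun x => g x * Ψ x) volume := hg2.integrable_mul hΨ2
  set H : ℝ → ℝ := fun t => ∫ x, u t x * Ψ x with hH
  set H₁ : ℝ → ℝ := fun t => ∫ x, ut t x * Ψ x with hH₁
  have hH0 : H 0 = ε * ∫ x, f x * Ψ x := by
    simp only [hH]
    rw [← integral_const_mul]
    refine integral_congr_ae ?_
    filter_upwards [hu.initial_value] with x hx
    rw [hx]; ring
  have hG0 : ∫ x, ε * g x * Ψ x = H₁ 0 := by
    simp only [hH₁]
    refine integral_congr_ae ?_
    filter_upwards [hut0] with x hx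
    rw [hx]
  have hH10 : H₁ 0 = ε * ∫ x, g x * Ψ x := by
    rw [← hG0, ← integral_const_mul]
    simp_rw [← mul_assoc]
  have hHder : ∀ t ∈ Icc 0 τ, HasDerivWithinAt H (H₁ t) (Icc 0 τ) t := by
    intro t ht
    have h1 := (innerSL ℝ hΨ2.toLp).hasFDerivAt.comp_hasDerivWithinAt t
      ((hderiv t (hsubT ht)).mono hsubT)
    simp only [hH, hH₁, integral_mul_eq_inner hΨ2]
    exact h1
  have hH1c : ContinuousOn H₁ (Icc 0 τ) := by
    simp only [hH₁, integral_mul_eq_inner hΨ2]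
    exact (innerSL ℝ hΨ2.toLp).continuous.comp_continuousOn (hcut.mono hsubT)
  have hHc : ContinuousOn H (Icc 0 τ) := fun t ht => (hHder t ht).continuousWithinAt
  -- The initial flux is ε ∫ (d f + g) Ψ. The integrand is nonnegative and Ψ ≥ 1 on the ball of
  -- radius R, so restricting to the ball and replacing Ψ by 1 only lowers it.
  have hinit : (ε * ∫ x in Metric.closedBall 0 R, (d * f x + g x)) ≤ H₁ 0 + d * H 0 := by
    have h1 : H₁ 0 + d * H 0 = ε * ∫ x, (d * f x + g x) * Ψ x := by
      rw [hH0, hH10, mul_left_comm, ← mul_add]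
      congr 1
      rw [← integral_const_mul, ← integral_add hgΨ (hfΨ.const_mul d)]
      refine integral_congr_ae (Eventually.of_forall fun x => ?_)
      simp only; ring
    rw [h1]
    refine mul_le_mul_of_nonneg_left ?_ hε
    have hI : Integrable (fun x => (d * f x + g x) * Ψ x) volume :=
      ((hf2.const_mul d).add hg2).integrable_mul hΨ2
    have h2 : ∫ x in Metric.closedBall 0 R, (d * f x + g x) * Ψ x ≤
        ∫ x, (d * f x + g x) * Ψ x := by
      refine setIntegral_le_integral hI ?_
      filter_upwards [hh0] with x hx using mul_nonneg hx (hΨ0 x)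
    refine le_trans ?_ h2
    refine setIntegral_mono_on_ae ?_ hI.integrableOn Metric.isClosed_closedBall.measurableSet ?_
    · have : MemLp (fun x => d * f x + g x) 2 (volume.restrict (Metric.closedBall (0 : Space n) R)) :=
        ((hf2.const_mul d).add hg2).restrict _
      have hfin : IsFiniteMeasure (volume.restrict (Metric.closedBall (0 : Space n) R)) :=
        ⟨by rw [Measure.restrict_apply_univ]; exact measure_closedBall_lt_top⟩
      exact this.integrable (by norm_num)
    · filter_upwards [hh0] with x hx hxR
      rw [mem_closedBall_zero_iff] at hxR
      exact le_mul_of_one_le_right hx (hΨ1 x (by linarith))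
  have hθ : ContDiffOn ℝ ∞ (fun s : ℝ => (1 + s) ^ b) (Ioi (-1)) := by
    intro s hs
    have hs' : (1 + s) ≠ 0 := by have := mem_Ioi.1 hs; linarith
    exact ((contDiffAt_const.add contDiffAt_id).rpow_const_of_ne hs').contDiffWithinAt
  -- This is the exact flux identity, from the test function (1+s)^b Ψ. The time derivative of the
  -- weight contributes -b and the damping μ, leaving the coefficient μ - b = d.
  have hid : ∀ t ∈ Icc 0 τ, (1 + t) ^ b * H₁ t + d * H t = H₁ 0 + d * H 0 +
      e * (∫ s in 0..t, (1 + s) ^ b * H s) +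
      ∫ s in 0..t, (1 + s) ^ b * ∫ x, |u s x| ^ p * Ψ x := by
    intro t ht
    have h1 := weighted_moment_identity hgrad hweak hcone hΨ hΨc hlap hθ (hsubT ht)
      (by linarith [ht.2])
    rw [hG0] at h1
    simp only [add_zero, Real.one_rpow, one_mul] at h1
    rw [← h1]
    have hsub : Icc 0 t ⊆ Icc 0 τ := Icc_subset_Icc_right ht.2
    have hu' : uIcc 0 t = Icc 0 t := uIcc_of_le ht.1
    have hpow : ContinuousOn (fun s : ℝ => (1 + s) ^ b) (Icc 0 t) :=
      ContinuousOn.rpow_const (by fun_prop) fun x hx => Or.inr hb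
    have hIH : IntervalIntegrable (fun s => (1 + s) ^ b * H s) volume 0 t := by
      apply ContinuousOn.intervalIntegrable
      rw [hu']
      exact hpow.mul (hHc.mono hsub)
    have hpow1 : ContinuousOn (fun s : ℝ => (1 + s) ^ (b - 1)) (Icc 0 t) :=
      ContinuousOn.rpow_const (by fun_prop) fun x hx => Or.inl (by linarith [hx.1])
    have hIH1 : IntervalIntegrable (fun s => (1 + s) ^ (b - 1) * H₁ s) volume 0 t := by
      apply ContinuousOn.intervalIntegrable
      rw [hu']
      exact hpow1.mul (hH1c.mono hsub)
    have c1 : ∫ s in 0..t, (-(deriv (fun s : ℝ => (1 + s) ^ b) s * H₁ s)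
          - e * ((1 + s) ^ b * H s)) =
        ∫ s in 0..t, ((-b) * ((1 + s) ^ (b - 1) * H₁ s) - e * ((1 + s) ^ b * H s)) := by
      refine intervalIntegral.integral_congr fun s hs => ?_
      rw [hu'] at hs
      have hs' : (1 + s) ≠ 0 := by linarith [hs.1]
      have := (((hasDerivAt_id s).const_add 1).rpow_const (p := b) (Or.inl hs')).deriv
      simp only [id_eq] at this
      simp only [this]; ring
    have c2 : ∫ s in 0..t, μ / (1 + s) * (1 + s) ^ b * H₁ s =
        ∫ s in 0..t, μ * ((1 + s) ^ (b - 1) * H₁ s) := by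
      refine intervalIntegral.integral_congr fun s hs => ?_
      rw [hu'] at hs
      have hs' : (1 + s) ≠ 0 := by linarith [hs.1]
      simp only [Real.rpow_sub_one hs']
      ring
    -- Either d = 0 or the weight (1+s)^{b-1} is 1, so the remaining term integrates to d (H(t) -
    -- H(0)).
    have c3 : d * ∫ s in 0..t, (1 + s) ^ (b - 1) * H₁ s = d * (H t - H 0) := by
      rcases hw with hd0 | hb1
      · simp [hd0]
      · congr 1
        simp only [hb1, sub_self, Real.rpow_zero, one_mul]
        refine intervalIntegral.integral_eq_sub_of_hasDeriv_right_of_le ht.1 (hHc.mono hsub)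
          (fun s hs => ?_) ?_
        · have hs' : s ∈ Icc 0 τ := hsub ⟨hs.1.le, hs.2.le⟩
          have := (hHder s hs').hasDerivAt (Icc_mem_nhds hs.1 (hs.2.trans_le ht.2))
          exact this.hasDerivWithinAt
        · apply ContinuousOn.intervalIntegrable
          rw [hu']
          exact hH1c.mono hsub
    simp only [hH₁, hH] at c1 c2 c3 hIH hIH1 ⊢
    rw [c1, c2, intervalIntegral.integral_sub (hIH1.const_mul _) (hIH.const_mul _),
      intervalIntegral.integral_const_mul, intervalIntegral.integral_const_mul,
      intervalIntegral.integral_const_mul]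
    rw [← hbd]
    linarith
  have hN0 : ∀ t ∈ Icc 0 τ, 0 ≤ ∫ s in 0..t, (1 + s) ^ b * ∫ x, |u s x| ^ p * Ψ x := by
    intro t ht
    refine intervalIntegral.integral_nonneg ht.1 fun s hs => ?_
    refine mul_nonneg (Real.rpow_nonneg (by linarith [hs.1]) _) (integral_nonneg fun x => ?_)
    exact mul_nonneg (Real.rpow_nonneg (abs_nonneg _) _) (hΨ0 x)
  refine ⟨H₁, ⟨hb, hd, hw, hHder, hH1c, ?_, fun t ht => ?_⟩, fun he0 hq t ht => ?_⟩
  · rw [hH0]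
    refine mul_nonneg hε (integral_nonneg_of_ae ?_)
    filter_upwards [hf0] with x hx using mul_nonneg hx (hΨ0 x)
  · rw [hid t ht]
    linarith [hN0 t ht]
  · have := hid t ht
    rw [he0] at this
    linarith

end DampedWave

/-! ### Hölder's inequality on balls and the L^q size of the eigenfunction -/

namespace DampedWave

variable {n : ℕ}

theorem isFiniteMeasure_restrict_closedBall (ρ : ℝ) :
    IsFiniteMeasure (volume.restrict (Metric.closedBall (0 : Space n) ρ)) :=
  ⟨by rw [Measure.restrict_apply_univ]; exact measure_closedBall_lt_top⟩

theorem abs_integral_mul_rpow_le {p q ρ : ℝ} (hpq : p.HolderConjugate q) {w Φ : Space n → ℝ}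
    (hw : MemLp w (ENNReal.ofReal p) (volume.restrict (Metric.closedBall 0 ρ)))
    (hΦ : Continuous Φ) (hΦ0 : ∀ x, 0 ≤ Φ x) :
    |∫ x in Metric.closedBall 0 ρ, w x * Φ x| ^ p ≤
      (∫ x in Metric.closedBall 0 ρ, |w x| ^ p) *
        (∫ x in Metric.closedBall 0 ρ, Φ x ^ q) ^ (p - 1) := by
  have hp0 := hpq.pos
  have hΦq : MemLp Φ (ENNReal.ofReal q) (volume.restrict (Metric.closedBall 0 ρ)) := by
    obtain ⟨C, hC⟩ := (isCompact_closedBall (0 : Space n) ρ).exists_bound_of_continuousOn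
      hΦ.continuousOn
    have := isFiniteMeasure_restrict_closedBall (n := n) ρ
    refine MemLp.of_bound hΦ.aestronglyMeasurable C ?_
    filter_upwards [ae_restrict_mem Metric.isClosed_closedBall.measurableSet] with x hx
    exact hC x hx
  have h1 : |∫ x in Metric.closedBall 0 ρ, w x * Φ x| ≤
      ∫ x in Metric.closedBall 0 ρ, |w x| * Φ x := by
    refine (abs_integral_le_integral_abs).trans (le_of_eq ?_)
    refine integral_congr_ae (Eventually.of_forall fun x => ?_)
    simp only [abs_mul, abs_of_nonneg (hΦ0 x)]
  have h2 := integral_mul_le_Lp_mul_Lq_of_nonneg hpq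
    (μ := volume.restrict (Metric.closedBall (0 : Space n) ρ)) (f := fun x => |w x|) (g := Φ)
    (Eventually.of_forall fun x => abs_nonneg _) (Eventually.of_forall hΦ0) hw.abs hΦq
  have hA : 0 ≤ ∫ x in Metric.closedBall 0 ρ, |w x| ^ p :=
    integral_nonneg fun x => Real.rpow_nonneg (abs_nonneg _) _
  have hB : 0 ≤ ∫ x in Metric.closedBall 0 ρ, Φ x ^ q :=
    integral_nonneg fun x => Real.rpow_nonneg (hΦ0 x) _
  have h3 := Real.rpow_le_rpow (abs_nonneg _) (h1.trans h2) hp0.le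
  refine h3.trans (le_of_eq ?_)
  rw [Real.mul_rpow (by positivity) (by positivity), ← Real.rpow_mul hA, ← Real.rpow_mul hB,
    one_div_mul_cancel hp0.ne', Real.rpow_one]
  congr 2
  rw [one_div_mul_eq_div, hpq.div_conj_eq_sub_one]

theorem exists_rpow_le_exp (a : ℝ) {c : ℝ} (hc : 0 < c) (ha : 0 ≤ a) :
    ∃ C > (0 : ℝ), ∀ x : ℝ, 0 ≤ x → (1 + x) ^ a ≤ C * Real.exp (c * x) := by
  set k := c / (a + 1) with hk
  have hk0 : 0 < k := by positivity
  refine ⟨(max 1 (1 / k)) ^ a, by positivity, fun x hx => ?_⟩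
  have h1 : 1 + x ≤ max 1 (1 / k) * Real.exp (k * x) := by
    have e1 := Real.add_one_le_exp (k * x)
    have e2 : (1 : ℝ) ≤ max 1 (1 / k) := le_max_left _ _
    have e3 : 1 ≤ max 1 (1 / k) * k := by
      rw [← div_le_iff₀ hk0]; exact le_max_right _ _
    have e4 : max 1 (1 / k) * (k * x + 1) ≤ max 1 (1 / k) * Real.exp (k * x) := by gcongr
    nlinarith
  refine (Real.rpow_le_rpow (by linarith) h1 ha).trans ?_
  rw [Real.mul_rpow (by positivity) (by positivity), ← Real.exp_mul]
  refine mul_le_mul_of_nonneg_left (Real.exp_le_exp.2 ?_) (by positivity)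
  have : k * a ≤ c := by
    rw [hk, div_mul_eq_mul_div, div_le_iff₀ (by linarith)]
    nlinarith
  nlinarith

/-- The integral concentrates near y = ρ: the ratio (1+y)^σ/(1+ρ)^σ is at most (1+ρ-y)^{|σ|} for
either sign of σ, and half of the exponential decay in ρ - y absorbs it. -/
theorem exists_integral_rpow_mul_exp_le (σ : ℝ) {q : ℝ} (hq : 0 < q) :
    ∃ C > (0 : ℝ), ∀ ρ : ℝ, 0 ≤ ρ →
      ∫ y in (0 : ℝ)..ρ, (1 + y) ^ σ * Real.exp (q * y) ≤ C * (1 + ρ) ^ σ * Real.exp (q * ρ) := by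
  obtain ⟨C, hC, hCx⟩ := exists_rpow_le_exp |σ| (half_pos hq) (abs_nonneg σ)
  refine ⟨C * (2 / q), by positivity, fun ρ hρ => ?_⟩
  have hpt : ∀ y ∈ Icc 0 ρ, (1 + y) ^ σ * Real.exp (q * y) ≤
      C * (1 + ρ) ^ σ * Real.exp (q / 2 * ρ) * Real.exp (q / 2 * y) := by
    intro y hy
    have hy0 := hy.1
    have h1 : (1 + y) ^ σ ≤ (1 + ρ) ^ σ * (1 + (ρ - y)) ^ |σ| := by
      rcases le_total 0 σ with hσ | hσ
      · have e1 : (1 + y) ^ σ ≤ (1 + ρ) ^ σ :=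
          Real.rpow_le_rpow (by linarith) (by linarith [hy.2]) hσ
        have e2 : 1 ≤ (1 + (ρ - y)) ^ |σ| :=
          Real.one_le_rpow (by linarith [hy.2]) (abs_nonneg _)
        exact e1.trans (le_mul_of_one_le_right (by positivity) e2)
      · have e1 : (1 + ρ) ^ |σ| ≤ (1 + y) ^ |σ| * (1 + (ρ - y)) ^ |σ| := by
          rw [← Real.mul_rpow (by linarith) (by linarith [hy.2])]
          refine Real.rpow_le_rpow (by linarith) ?_ (abs_nonneg _)
          nlinarith [hy.2]
        have hσ' : σ = -|σ| := by rw [abs_of_nonpos hσ]; ring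
        have e2 : (1 + y) ^ σ = ((1 + y) ^ |σ|)⁻¹ := by
          rw [← Real.rpow_neg (by linarith), ← hσ']
        have e3 : (1 + ρ) ^ σ = ((1 + ρ) ^ |σ|)⁻¹ := by
          rw [← Real.rpow_neg (by linarith), ← hσ']
        have p1 : 0 < (1 + y) ^ |σ| := by positivity
        have p2 : 0 < (1 + ρ) ^ |σ| := by positivity
        rw [e2, e3, ← div_eq_inv_mul, le_div_iff₀ p2, ← div_eq_inv_mul, div_le_iff₀ p1]
        linarith
    have h2 := hCx (ρ - y) (by linarith [hy.2])
    have e : Real.exp (q / 2 * (ρ - y)) * Real.exp (q * y) =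
        Real.exp (q / 2 * ρ) * Real.exp (q / 2 * y) := by
      rw [← Real.exp_add, ← Real.exp_add]; congr 1; ring
    calc (1 + y) ^ σ * Real.exp (q * y)
        ≤ (1 + ρ) ^ σ * (C * Real.exp (q / 2 * (ρ - y))) * Real.exp (q * y) := by
          gcongr
          exact h1.trans (by gcongr)
      _ = C * (1 + ρ) ^ σ * (Real.exp (q / 2 * (ρ - y)) * Real.exp (q * y)) := by ring
      _ = _ := by rw [e]; ring
  have hI : IntervalIntegrable (fun y : ℝ => (1 + y) ^ σ * Real.exp (q * y)) volume 0 ρ := by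
    apply ContinuousOn.intervalIntegrable
    rw [uIcc_of_le hρ]
    refine (ContinuousOn.rpow_const (by fun_prop) fun x hx => Or.inl ?_).mul (by fun_prop)
    linarith [hx.1]
  refine (intervalIntegral.integral_mono_on hρ hI (Continuous.intervalIntegrable (by fun_prop) _ _)
    hpt).trans ?_
  rw [intervalIntegral.integral_const_mul]
  have h3 : ∫ y in (0 : ℝ)..ρ, Real.exp (q / 2 * y) ≤ 2 / q * Real.exp (q / 2 * ρ) := by
    rw [intervalIntegral.integral_comp_mul_left (fun y => Real.exp y) (half_pos hq).ne',
      integral_exp]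
    simp only [mul_zero, Real.exp_zero, smul_eq_mul, inv_div]
    gcongr
    linarith
  have e : Real.exp (q * ρ) = Real.exp (q / 2 * ρ) * Real.exp (q / 2 * ρ) := by
    rw [← Real.exp_add]; congr 1; ring
  calc _ ≤ C * (1 + ρ) ^ σ * Real.exp (q / 2 * ρ) * (2 / q * Real.exp (q / 2 * ρ)) := by gcongr
    _ = _ := by rw [e]; ring

/-- In polar coordinates the integrand is at most a multiple of (1+y)^{(n-1)(1-q/2)} e^{qy}, from
y^{n-1} and the q-th power of the bound in `exists_besselSeries_le`. -/
theorem exists_integral_radialProfile_rpow_le (hn : 1 ≤ n) {q : ℝ} (hq : 0 < q) :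
    ∃ C > (0 : ℝ), ∀ ρ : ℝ, 0 ≤ ρ →
      ∫ x in Metric.closedBall (0 : Space n) ρ, radialProfile n 1 x ^ q ≤
        C * (1 + ρ) ^ (((n : ℝ) - 1) * (1 - q / 2)) * Real.exp (q * ρ) := by
  obtain ⟨m, rfl⟩ : ∃ m, n = m + 1 := ⟨n - 1, by omega⟩
  obtain ⟨C₁, hC₁, h₁⟩ := exists_besselSeries_le m
  obtain ⟨C₂, hC₂, h₂⟩ := exists_integral_rpow_mul_exp_le ((m : ℝ) * (1 - q / 2)) hq
  have hvol : 0 < volume.real (Metric.ball (0 : Space (m + 1)) 1) :=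
    ENNReal.toReal_pos (Metric.measure_ball_pos _ _ one_pos).ne' measure_ball_lt_top.ne
  refine ⟨(m + 1) * volume.real (Metric.ball (0 : Space (m + 1)) 1) * C₁ ^ q * C₂,
    by positivity, fun ρ hρ => ?_⟩
  -- The ball is encoded in a radial function so that the polar formula on the whole space applies.
  set F : ℝ → ℝ := (Iic ρ).indicator fun y => besselSeries (m + 1) (y ^ 2) ^ q with hF
  have e1 : ∫ x in Metric.closedBall (0 : Space (m + 1)) ρ, radialProfile (m + 1) 1 x ^ q =
      ∫ x : Space (m + 1), F ‖x‖ := by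
    rw [← integral_indicator Metric.isClosed_closedBall.measurableSet]
    refine integral_congr_ae (Eventually.of_forall fun x => ?_)
    by_cases hx : ‖x‖ ≤ ρ <;> simp [hF, indicator, hx, radialProfile]
  have hdim : Module.finrank ℝ (Space (m + 1)) = m + 1 := by simp
  have e2 : ∫ y in Ioi (0 : ℝ), y ^ m • F y =
      ∫ y in (0 : ℝ)..ρ, y ^ m * besselSeries (m + 1) (y ^ 2) ^ q := by
    rw [intervalIntegral.integral_of_le hρ, ← Ioi_inter_Iic,
      ← setIntegral_indicator measurableSet_Iic]
    refine integral_congr_ae (Eventually.of_forall fun y => ?_)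
    simp only [hF, indicator_apply, smul_eq_mul]
    split_ifs <;> simp
  have hb0 : ∀ y : ℝ, 0 ≤ besselSeries (m + 1) (y ^ 2) := fun y =>
    zero_le_one.trans (one_le_besselSeries (by omega) (sq_nonneg y))
  have hcb : Continuous (besselSeries (m + 1)) := (contDiff_besselSeries (by omega)).continuous
  have e3 : ∫ y in (0 : ℝ)..ρ, y ^ m * besselSeries (m + 1) (y ^ 2) ^ q ≤
      ∫ y in (0 : ℝ)..ρ, C₁ ^ q * ((1 + y) ^ ((m : ℝ) * (1 - q / 2)) * Real.exp (q * y)) := by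
    refine intervalIntegral.integral_mono_on hρ ?_ ?_ fun y hy => ?_
    · refine Continuous.intervalIntegrable ?_ _ _
      exact (continuous_pow m).mul ((hcb.comp (continuous_pow 2)).rpow_const fun _ => Or.inr hq.le)
    · apply ContinuousOn.intervalIntegrable
      rw [uIcc_of_le hρ]
      refine continuousOn_const.mul
        ((ContinuousOn.rpow_const (by fun_prop) fun x hx => Or.inl ?_).mul (by fun_prop))
      linarith [hx.1]
    · have hy0 := hy.1
      have h3 := Real.rpow_le_rpow (hb0 y) (h₁ y hy0) hq.le
      have h4 : (C₁ * (1 + y) ^ (-(m : ℝ) / 2) * Real.exp y) ^ q =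
          C₁ ^ q * (1 + y) ^ (-(m : ℝ) / 2 * q) * Real.exp (q * y) := by
        rw [Real.mul_rpow (by positivity) (by positivity), Real.mul_rpow (by positivity)
          (by positivity), ← Real.rpow_mul (by linarith), ← Real.exp_mul, mul_comm y q]
      have h5 : y ^ m ≤ (1 + y) ^ (m : ℝ) := by
        rw [Real.rpow_natCast]; exact pow_le_pow_left₀ hy0 (by linarith) m
      rw [h4] at h3
      calc _ ≤ (1 + y) ^ (m : ℝ) * (C₁ ^ q * (1 + y) ^ (-(m : ℝ) / 2 * q) * Real.exp (q * y)) :=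
            mul_le_mul h5 h3 (Real.rpow_nonneg (hb0 y) _) (by positivity)
        _ = C₁ ^ q * ((1 + y) ^ (m : ℝ) * (1 + y) ^ (-(m : ℝ) / 2 * q) * Real.exp (q * y)) := by
            ring
        _ = _ := by
            rw [← Real.rpow_add (by linarith)]
            congr 4; ring
  rw [e1, integral_fun_norm_addHaar volume F, hdim, Nat.add_sub_cancel, e2]
  rw [intervalIntegral.integral_const_mul] at e3
  have h6 := e3.trans (mul_le_mul_of_nonneg_left (h₂ ρ hρ) (by positivity))
  simp only [smul_eq_mul, nsmul_eq_mul]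
  push_cast
  rw [show ((m : ℝ) + 1 - 1) = m by ring]
  calc _ ≤ ((m : ℝ) + 1) * (volume.real (Metric.ball (0 : Space (m + 1)) 1) *
        (C₁ ^ q * (C₂ * (1 + ρ) ^ ((m : ℝ) * (1 - q / 2)) * Real.exp (q * ρ)))) := by gcongr
    _ = _ := by ring

theorem volume_real_closedBall (hn : 1 ≤ n) {ρ : ℝ} (hρ : 0 ≤ ρ) :
    volume.real (Metric.closedBall (0 : Space n) ρ) =
      volume.real (Metric.ball (0 : Space n) 1) * ρ ^ (n : ℝ) := by
  have : Nonempty (Fin n) := ⟨⟨0, hn⟩⟩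
  rw [measureReal_def, Measure.addHaar_closedBall _ _ hρ, ENNReal.toReal_mul,
    ENNReal.toReal_ofReal (by positivity), measureReal_def]
  simp [mul_comm]

end DampedWave

/-! ### Lower bounds for the source and for the mass -/

namespace DampedWave

variable {n : ℕ} {μ p ε T R : ℝ} {f g : Space n → ℝ}
  {u : ℝ → Lp ℝ 2 (volume : Measure (Space n))}

/-- Finite speed of propagation lets the cutoff be exchanged for the true eigenfunction, integrated
over a ball where Hölder's inequality is available. -/
theorem SupportedInCone.integral_eq (hcone : SupportedInCone R T u) {s : ℝ} (hs : s ∈ Ico 0 T)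
    {F : ℝ → ℝ} (hF : F 0 = 0) (Ψ Φ : Space n → ℝ) {r : ℝ} (hr : s + R ≤ r)
    (hΨΦ : ∀ x, ‖x‖ ≤ r → Ψ x = Φ x) :
    ∫ x, F (u s x) * Ψ x = ∫ x in Metric.closedBall 0 r, F (u s x) * Φ x := by
  rw [← setIntegral_eq_integral_of_ae_compl_eq_zero (s := Metric.closedBall (0 : Space n) r)]
  · refine setIntegral_congr_fun Metric.isClosed_closedBall.measurableSet fun x hx => ?_
    rw [mem_closedBall_zero_iff] at hx
    simp only [hΨΦ x hx]
  · filter_upwards [hcone s hs] with x hx hxr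
    rw [mem_closedBall_zero_iff, not_le] at hxr
    rw [hx (by linarith), hF, zero_mul]

theorem rpow_two_sided {x y k a : ℝ} (hx : 0 < x) (hxy : x ≤ y) (hyk : y ≤ k * x) (hk : 1 ≤ k) :
    y ^ a ≤ k ^ |a| * x ^ a ∧ x ^ a ≤ k ^ |a| * y ^ a := by
  have hy : 0 < y := by linarith
  have hk0 : 0 < k := by linarith
  have h1 : 1 ≤ k ^ |a| := Real.one_le_rpow hk (abs_nonneg _)
  rcases le_total 0 a with ha | ha
  · rw [abs_of_nonneg ha] at h1 ⊢
    refine ⟨?_, ?_⟩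
    · rw [← Real.mul_rpow hk0.le hx.le]
      exact Real.rpow_le_rpow hy.le hyk ha
    · exact (Real.rpow_le_rpow hx.le hxy ha).trans (le_mul_of_one_le_left (by positivity) h1)
  · rw [abs_of_nonpos ha] at h1 ⊢
    refine ⟨?_, ?_⟩
    · exact (Real.rpow_le_rpow_of_nonpos hx hxy ha).trans
        (le_mul_of_one_le_left (by positivity) h1)
    · rw [Real.rpow_neg hk0.le, ← div_eq_inv_mul, le_div_iff₀ (by positivity), mul_comm,
        ← Real.mul_rpow hk0.le hx.le]
      exact Real.rpow_le_rpow_of_nonpos hy hyk ha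

/-- Lower bounds for `∫ |u|^p` by the mass of `u` and by the exponential moment of `u`. -/
theorem exists_source_bounds (hn : 1 ≤ n) (hp : 1 < p) (hR : 0 ≤ R) {b d : ℝ}
    (hb : 0 ≤ b) (hd : 0 ≤ d) (hbd : b + d = μ) (hw : d = 0 ∨ b = 1)
    (hf2 : MemLp f 2 volume) (hg2 : MemLp g 2 volume) (hf0 : ∀ᵐ x, 0 ≤ f x)
    (hh0 : ∀ᵐ x, 0 ≤ d * f x + g x)
    (hc : 0 < ∫ x in Metric.closedBall 0 R, (d * f x + g x)) :
    ∃ c₁ > (0 : ℝ), ∃ c₂ > (0 : ℝ), ∀ ε : ℝ, 0 < ε → ∀ T : ℝ,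
      ∀ u : ℝ → Lp ℝ 2 (volume : Measure (Space n)), IsEnergySolution μ p ε f g T u →
      SupportedInCone R T u → ∀ τ ∈ Ico 0 T, ∃ F F₁ N : ℝ → ℝ,
        MomentBound b d 0 (ε * ∫ x in Metric.closedBall 0 R, (d * f x + g x)) τ F F₁ ∧
        IntervalIntegrable N volume 0 τ ∧ (∀ s ∈ Icc 0 τ, 0 ≤ N s) ∧
        (∀ t ∈ Icc 0 τ, (∫ s in 0..t, (1 + s) ^ b * N s) ≤ (1 + t) ^ b * F₁ t + d * F t) ∧
        (∀ s ∈ Icc 1 τ, c₁ * s ^ (-(n * (p - 1))) * |F s| ^ p ≤ N s) ∧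
        (∀ s ∈ Icc 1 τ, c₂ * ε ^ p * s ^ ((n : ℝ) - 1 - (n + μ - 1) * p / 2) ≤ N s) := by
  set q := p / (p - 1) with hq
  have hpq : p.HolderConjugate q := Real.HolderConjugate.conjExponent hp
  have hp1 : 0 < p - 1 := by linarith
  have hq0 : 0 < q := hpq.symm.pos
  have hqp : q * (p - 1) = p := by rw [hq]; field_simp
  obtain ⟨C, hC, hCρ⟩ := exists_integral_radialProfile_rpow_le hn hq0
  have : Nonempty (Fin n) := ⟨⟨0, hn⟩⟩
  set c₀ := ∫ x in Metric.closedBall 0 R, (d * f x + g x) with hc₀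
  set V := volume.real (Metric.ball (0 : Space n) 1) with hV
  have hV0 : 0 < V :=
    ENNReal.toReal_pos (Metric.measure_ball_pos _ _ one_pos).ne' measure_ball_lt_top.ne
  set a := ((n : ℝ) - 1) * (1 - q / 2) * (p - 1) with ha
  -- The first constant comes from the volume of the ball of radius s + R ≤ (1+R) s. In the second,
  -- c₀/8 is the constant of `ge_exp`; the other factors come from the L^q bound and from replacing
  -- 1 + s and 1 + s + R by s, for s ≥ 1.
  refine ⟨((V * (1 + R) ^ (n : ℝ)) ^ (p - 1))⁻¹, by positivity,
    (c₀ / 8) ^ p * ((2 : ℝ) ^ |-(μ * p / 2)|)⁻¹ * (C ^ (p - 1) * (2 + R) ^ |a| * Real.exp (p * R))⁻¹,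
    by positivity, fun ε hε T u hu hcone τ hτ => ?_⟩
  -- The extra 1 puts every closed ball of radius s + R, s ≤ τ, strictly inside the region where the
  -- cutoffs agree with the eigenfunctions.
  have hρ : 0 < τ + R + 1 := by linarith [hτ.1]
  obtain ⟨Ψ, hΨ, hΨc, hΨ0, hΨeq, hlap⟩ := exists_cutoff_radialProfile hn le_rfl hρ
  obtain ⟨Ψ', hΨ', hΨc', hΨ0', hΨeq', hlap'⟩ := exists_cutoff_radialProfile hn zero_le_one hρ
  obtain ⟨F₁, hF, hflux⟩ := hu.exists_moment hb hd hbd hw hcone hε.le hf2 hg2 hf0 hh0 hτ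
    (by linarith) (by linarith [hτ.1]) hΨ hΨc hΨ0
    (fun x hx => by rw [hΨeq x hx]; exact one_le_radialProfile hn le_rfl x) hlap
  obtain ⟨H₁, hH, -⟩ := hu.exists_moment hb hd hbd hw hcone hε.le hf2 hg2 hf0 hh0 hτ
    (by linarith) (by linarith [hτ.1]) hΨ' hΨc' hΨ0'
    (fun x hx => by rw [hΨeq' x hx]; exact one_le_radialProfile hn zero_le_one x) hlap'
  have hsT : ∀ s ∈ Icc 0 τ, s ∈ Ico 0 T := fun s hs => ⟨hs.1, hs.2.trans_lt hτ.2⟩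
  have hzero : (fun y : ℝ => |y| ^ p) 0 = 0 := by
    simp [Real.zero_rpow (by linarith : p ≠ 0)]
  have hone : ∀ x, ‖x‖ < τ + R + 1 → Ψ x = 1 := fun x hx => by
    rw [hΨeq x hx, radialProfile_zero]
  have hNball : ∀ s ∈ Icc 0 τ, ∀ r, s + R ≤ r → r < τ + R + 1 →
      ∫ x, |u s x| ^ p * Ψ x = ∫ x in Metric.closedBall 0 r, |u s x| ^ p := by
    intro s hs r hr hr'
    have := hcone.integral_eq (F := fun y => |y| ^ p) (hsT s hs) hzero Ψ (fun _ => 1) hr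
      (fun x hx => hone x (by linarith))
    simpa using this
  have hlocal : ∀ s ∈ Icc 1 τ, MemLp (u s) (ENNReal.ofReal p)
      (volume.restrict (Metric.closedBall 0 (s + R))) := fun s hs =>
    (hu.continuousIntoLpLoc _ (isCompact_closedBall 0 (s + R)) s
      ⟨by linarith [hs.1], hs.2.trans_lt hτ.2⟩).1
  have hN0 : ∀ s, 0 ≤ ∫ x, |u s x| ^ p * Ψ x := fun s =>
    integral_nonneg fun x => mul_nonneg (Real.rpow_nonneg (abs_nonneg _) _) (hΨ0 x)
  refine ⟨_, F₁, fun s => ∫ x, |u s x| ^ p * Ψ x, hF, ?_, fun s _ => hN0 s,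
    hflux rfl (by positivity), fun s hs => ?_, fun s hs => ?_⟩
  · have h1 := hu.integrable_nonlinearity _ (isCompact_closedBall 0 (τ + R)) τ hτ
    refine h1.congr fun s hs => ?_
    rw [uIoc_of_le hτ.1] at hs
    exact (hNball s ⟨hs.1.le, hs.2⟩ (τ + R) (by linarith [hs.2]) (by linarith)).symm
  · have hs0 : 0 < s := by linarith [hs.1]
    have hs' : s ∈ Icc 0 τ := ⟨hs0.le, hs.2⟩
    have h1 := abs_integral_mul_rpow_le hpq (hlocal s hs) (Φ := fun _ => 1) continuous_const
      (fun _ => zero_le_one)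
    rw [← hNball s hs' (s + R) le_rfl (by linarith [hs.2]),
      ← hcone.integral_eq (hsT s hs') (F := fun y => y) rfl Ψ (fun _ => 1) le_rfl
        (fun x hx => hone x (by linarith [hs.2]))] at h1
    simp only [Real.one_rpow] at h1
    rw [integral_const, smul_eq_mul, mul_one, measureReal_restrict_apply_univ,
      volume_real_closedBall hn (by linarith), ← hV] at h1
    have h2 : (V * (s + R) ^ (n : ℝ)) ^ (p - 1) ≤
        (V * (1 + R) ^ (n : ℝ)) ^ (p - 1) * s ^ (n * (p - 1)) := by
      rw [Real.rpow_mul hs0.le, ← Real.mul_rpow (by positivity) (by positivity), mul_assoc,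
        ← Real.mul_rpow (by positivity) hs0.le]
      refine Real.rpow_le_rpow (by positivity) ?_ hp1.le
      refine mul_le_mul_of_nonneg_left (Real.rpow_le_rpow (by linarith) ?_ (by positivity)) hV0.le
      nlinarith [hs.1]
    have h3 := h1.trans (mul_le_mul_of_nonneg_left h2 (hN0 s))
    rw [Real.rpow_neg hs0.le, ← mul_inv, ← div_eq_inv_mul, div_le_iff₀ (by positivity)]
    exact h3
  · have hs0 : 0 < s := by linarith [hs.1]
    have hs' : s ∈ Icc 0 τ := ⟨hs0.le, hs.2⟩
    have h1 := abs_integral_mul_rpow_le hpq (hlocal s hs)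
      (contDiff_radialProfile hn 1).continuous
      (fun x => zero_le_one.trans (one_le_radialProfile hn zero_le_one x))
    rw [← hNball s hs' (s + R) le_rfl (by linarith [hs.2]),
      ← hcone.integral_eq (hsT s hs') (F := fun y => y) rfl Ψ' (radialProfile n 1) le_rfl
        (fun x hx => hΨeq' x (by linarith [hs.2]))] at h1
    have h2 := hH.ge_exp (mul_pos hε hc) hs.1 hs.2
    have hI0 : 0 ≤ ∫ x in Metric.closedBall (0 : Space n) (s + R), radialProfile n 1 x ^ q :=
      integral_nonneg fun x => Real.rpow_nonneg
        (zero_le_one.trans (one_le_radialProfile hn zero_le_one x)) _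
    have h3 := Real.rpow_le_rpow hI0 (hCρ (s + R) (by linarith)) hp1.le
    have e3 : (C * (1 + (s + R)) ^ (((n : ℝ) - 1) * (1 - q / 2)) *
        Real.exp (q * (s + R))) ^ (p - 1) =
        C ^ (p - 1) * (1 + (s + R)) ^ a * (Real.exp (p * s) * Real.exp (p * R)) := by
      rw [Real.mul_rpow (by positivity) (by positivity), Real.mul_rpow (by positivity)
        (by positivity), ← Real.rpow_mul (by linarith), ← Real.exp_mul, ← Real.exp_add,
        mul_right_comm q, hqp, mul_add]
    rw [e3] at h3
    have h4 : (1 + (s + R)) ^ a ≤ (2 + R) ^ |a| * s ^ a :=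
      (rpow_two_sided hs0 (by linarith) (by nlinarith [hs.1]) (by linarith)).1
    have h5 : (ε * c₀ / 8 * (1 + s) ^ (-((b + d) / 2)) * Real.exp s) ^ p ≤
        |∫ x, u s x * Ψ' x| ^ p := by
      refine Real.rpow_le_rpow (by positivity) (h2.trans (le_abs_self _)) (by linarith)
    have e5 : (ε * c₀ / 8 * (1 + s) ^ (-((b + d) / 2)) * Real.exp s) ^ p =
        ε ^ p * (c₀ / 8) ^ p * (1 + s) ^ (-(μ * p / 2)) * Real.exp (p * s) := by
      rw [Real.mul_rpow (by positivity) (by positivity), Real.mul_rpow (by positivity)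
        (by positivity), ← Real.rpow_mul (by linarith), ← Real.exp_mul, mul_div_assoc,
        Real.mul_rpow hε.le (by positivity), hbd, mul_comm s p]
      congr 3; ring
    rw [e5] at h5
    have h6 : s ^ (-(μ * p / 2)) ≤ 2 ^ |-(μ * p / 2)| * (1 + s) ^ (-(μ * p / 2)) :=
      (rpow_two_sided hs0 (by linarith) (by linarith [hs.1]) (by norm_num)).2
    -- The factors e^{ps} of the moment and of the eigenfunction cancel; what remains is the
    -- quotient of s^{-μp/2} by s^a, with a = (n-1)(p/2-1).
    have e6 : s ^ ((n : ℝ) - 1 - (n + μ - 1) * p / 2) * s ^ a = s ^ (-(μ * p / 2)) := by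
      rw [← Real.rpow_add hs0]
      congr 1
      rw [ha, show ((n : ℝ) - 1) * (1 - q / 2) * (p - 1)
        = ((n : ℝ) - 1) * ((p - 1) - q * (p - 1) / 2) by ring, hqp]
      ring
    set N := ∫ x, |u s x| ^ p * Ψ x
    set P2 : ℝ := (2 : ℝ) ^ |-(μ * p / 2)|
    set W := C ^ (p - 1) * (2 + R) ^ |a| * Real.exp (p * R) with hW
    have hW0 : 0 < W := by positivity
    have hP2 : 0 < P2 := by positivity
    have h7 : ε ^ p * (c₀ / 8) ^ p * (1 + s) ^ (-(μ * p / 2)) * Real.exp (p * s) ≤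
        N * (W * s ^ a * Real.exp (p * s)) := by
      refine h5.trans (h1.trans ((mul_le_mul_of_nonneg_left h3 (hN0 s)).trans
        (mul_le_mul_of_nonneg_left ?_ (hN0 s))))
      calc C ^ (p - 1) * (1 + (s + R)) ^ a * (Real.exp (p * s) * Real.exp (p * R))
          ≤ C ^ (p - 1) * ((2 + R) ^ |a| * s ^ a) * (Real.exp (p * s) * Real.exp (p * R)) := by
            gcongr
        _ = _ := by rw [hW]; ring
    have h8 : ε ^ p * (c₀ / 8) ^ p * (1 + s) ^ (-(μ * p / 2)) ≤ N * (W * s ^ a) := by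
      refine le_of_mul_le_mul_right ?_ (Real.exp_pos (p * s))
      linarith
    have h9 : ε ^ p * (c₀ / 8) ^ p * s ^ (-(μ * p / 2)) ≤ N * (W * s ^ a) * P2 := by
      calc _ ≤ ε ^ p * (c₀ / 8) ^ p * (P2 * (1 + s) ^ (-(μ * p / 2))) := by gcongr
        _ = ε ^ p * (c₀ / 8) ^ p * (1 + s) ^ (-(μ * p / 2)) * P2 := by ring
        _ ≤ _ := by gcongr
    rw [← e6] at h9
    have hsa : 0 < s ^ a := by positivity
    refine le_of_mul_le_mul_right ?_ (mul_pos (mul_pos hsa hW0) hP2)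
    calc _ = ε ^ p * (c₀ / 8) ^ p * (s ^ ((n : ℝ) - 1 - (n + μ - 1) * p / 2) * s ^ a) := by
          field_simp
      _ ≤ _ := h9
      _ = _ := by ring

/-- The mass `F` of a solution on `[0,T)`: lower bounds, and the bound that self-forcing on
`[σ,2σ] ⊂ [0,T)` imposes. -/
theorem exists_mass_bounds (hn : 1 ≤ n) (hp : 1 < p) (hR : 0 ≤ R) {b d : ℝ}
    (hb : 0 ≤ b) (hd : 0 ≤ d) (hbd : b + d = μ) (hw : d = 0 ∨ b = 1)
    (hf2 : MemLp f 2 volume) (hg2 : MemLp g 2 volume) (hf0 : ∀ᵐ x, 0 ≤ f x)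
    (hh0 : ∀ᵐ x, 0 ≤ d * f x + g x)
    (hc : 0 < ∫ x in Metric.closedBall 0 R, (d * f x + g x)) :
    ∃ k > (0 : ℝ), ∃ K > (0 : ℝ), ∀ ε : ℝ, 0 < ε → ∀ T : ℝ,
      ∀ u : ℝ → Lp ℝ 2 (volume : Measure (Space n)), IsEnergySolution μ p ε f g T u →
      SupportedInCone R T u → ∀ σ : ℝ, 2 ≤ σ → 2 * σ < T → ∃ F : ℝ → ℝ,
        (∀ t ∈ Icc σ (2 * σ), k * ε * σ ^ (1 - b) ≤ F t) ∧
        (b = 1 → d = 0 → ∀ t ∈ Icc σ (2 * σ), k * ε * Real.log (1 + σ) ≤ F t) ∧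
        (∀ t ∈ Icc σ (2 * σ), k * ε ^ p * σ ^ ((n : ℝ) + 1 - (n + μ - 1) * p / 2) ≤ F t) ∧
        (∀ L > 0, (∀ t ∈ Icc σ (2 * σ), L ≤ F t) → σ ^ (2 - n * (p - 1)) * L ^ (p - 1) < K) := by
  obtain ⟨c₁, hc₁, c₂, hc₂, hall⟩ :=
    exists_source_bounds hn hp hR hb hd hbd hw hf2 hg2 hf0 hh0 hc
  set c₀ := ∫ x in Metric.closedBall 0 R, (d * f x + g x) with hc₀
  set β := (n : ℝ) - 1 - (n + μ - 1) * p / 2 with hβ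
  set k₁ := (2 : ℝ) ^ (-d - 2) * c₀ * ((4 : ℝ) ^ |1 - b|)⁻¹ with hk₁
  set k₃ := 2 ^ (-μ - 1) * (c₂ * ((2 : ℝ) ^ |β|)⁻¹) / 4 * ((2 : ℝ) ^ |β + 2|)⁻¹ with hk₃
  have hk₁0 : 0 < k₁ := by positivity
  have hk₃0 : 0 < k₃ := by positivity
  have hk : 0 < min (min k₁ c₀) k₃ := lt_min (lt_min hk₁0 hc) hk₃0
  refine ⟨min (min k₁ c₀) k₃, hk, 4 * 4 ^ (1 / (p - 1)) /
      (2 ^ (-μ - 1) * (c₁ * 2 ^ (-(n * (p - 1))))), by positivity,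
    fun ε hε T u hu hcone σ hσ hσT => ?_⟩
  have hσ0 : 0 < σ := by linarith
  obtain ⟨F, F₁, N, hF, hNI, hN0, hflux, hN1, hN2⟩ := hall ε hε T u hu hcone (2 * σ)
    ⟨by linarith, hσT⟩
  have hq := mul_pos hε hc
  have hduh : ∀ a t ν : ℝ, 1 ≤ a → a ≤ t → t ≤ 2 * a → t ≤ 2 * σ → 0 ≤ ν →
      (∀ s ∈ Icc a t, ν ≤ N s) → 2 ^ (-μ - 1) * ν * (t - a) ^ 2 ≤ F t := by
    intro a t ν h1 h2 h3 h4 h5 h6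
    have := hF.ge_of_source le_rfl hq hNI hN0 hflux h1 h2 h3 h4 h5 h6
    rwa [hbd] at this
  refine ⟨F, fun t ht => ?_, fun hb1 hd0 t ht => ?_, fun t ht => ?_, fun L hL hLF => ?_⟩
  · have h1 := hF.ge_rpow le_rfl hq (by linarith [ht.1] : 1 ≤ t) ht.2
    refine le_trans ?_ h1
    have h2 : σ ^ (1 - b) ≤ 4 ^ |1 - b| * (1 + t) ^ (1 - b) :=
      (rpow_two_sided hσ0 (by linarith [ht.1]) (by linarith [ht.2]) (by norm_num)).2
    have h3 : min (min k₁ c₀) k₃ ≤ k₁ := (min_le_left _ _).trans (min_le_left _ _)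
    calc _ ≤ k₁ * ε * (4 ^ |1 - b| * (1 + t) ^ (1 - b)) := by gcongr
      _ = _ := by
        rw [hk₁]
        field_simp
  · subst hb1 hd0
    have h1 := hF.ge_log le_rfl hq (t := t) ⟨by linarith [ht.1], ht.2⟩
    refine le_trans ?_ h1
    have h3 : min (min k₁ c₀) k₃ ≤ c₀ := (min_le_left _ _).trans (min_le_right _ _)
    have h4 : Real.log (1 + σ) ≤ Real.log (1 + t) :=
      Real.log_le_log (by linarith) (by linarith [ht.1])
    have h5 : 0 ≤ Real.log (1 + σ) := Real.log_nonneg (by linarith)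
    calc _ ≤ c₀ * ε * Real.log (1 + t) := by gcongr
      _ = _ := by ring
  · have ht0 : 0 < t := by linarith [ht.1]
    -- Two integrations over [t/2,t] of a source of order s^β gain the factor t².
    have h1 := hduh (t / 2) t (c₂ * ε ^ p * (((2 : ℝ) ^ |β|)⁻¹ * t ^ β)) (by linarith [ht.1])
      (by linarith) (by linarith) ht.2 (by positivity) (fun s hs => by
        refine le_trans ?_ (hN2 s ⟨by linarith [hs.1, ht.1], hs.2.trans ht.2⟩)
        have hs0 : 0 < s := by linarith [hs.1]
        refine mul_le_mul_of_nonneg_left ?_ (by positivity)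
        rw [← div_eq_inv_mul, div_le_iff₀ (by positivity), mul_comm]
        exact (rpow_two_sided hs0 hs.2 (by linarith [hs.1]) (by norm_num)).1)
    refine le_trans ?_ h1
    have e1 : t ^ (β + 2) = t ^ β * t ^ 2 := by
      rw [Real.rpow_add ht0]; norm_num
    have h2 : σ ^ (β + 2) ≤ 2 ^ |β + 2| * t ^ (β + 2) :=
      (rpow_two_sided hσ0 ht.1 ht.2 (by norm_num)).2
    have e2 : (n : ℝ) + 1 - (n + μ - 1) * p / 2 = β + 2 := by rw [hβ]; ring
    rw [e2]
    calc _ ≤ k₃ * ε ^ p * (2 ^ |β + 2| * t ^ (β + 2)) := by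
          gcongr
          exact min_le_right _ _
      _ = 2 ^ (-μ - 1) * (c₂ * ε ^ p * (((2 : ℝ) ^ |β|)⁻¹ * t ^ β)) * (t - t / 2) ^ 2 := by
          rw [hk₃, e1]
          field_simp
          ring
  · have hB : 0 < c₁ * (2 * σ) ^ (-(n * (p - 1))) := by positivity
    -- The decaying Hölder factor t^{-n(p-1)} is frozen at its minimum on [σ,2σ], attained at 2σ.
    have h1 := selfForcing_lt hp hσ0 (by positivity : (0 : ℝ) < 2 ^ (-μ - 1)) hB hL hLF
      (fun t ht => by
        refine le_trans ?_ (hN1 t ⟨by linarith [ht.1], ht.2⟩)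
        have hFt : 0 ≤ F t := hL.le.trans (hLF t ht)
        have ht0 : 0 < t := by linarith [ht.1]
        rw [abs_of_nonneg hFt]
        have : (2 * σ) ^ (-(n * (p - 1))) ≤ t ^ (-(n * (p - 1))) :=
          Real.rpow_le_rpow_of_nonpos ht0 ht.2 (by
            have : 0 ≤ (n : ℝ) * (p - 1) := mul_nonneg (by positivity) (by linarith)
            linarith)
        gcongr)
      (fun a t ν h1 h2 h3 h4 h5 => hduh a t ν (by linarith) h2 (by linarith) h3 h4 h5)
    rw [lt_div_iff₀ (by positivity)]
    refine lt_of_eq_of_lt ?_ h1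
    have e1 : σ ^ (2 - n * (p - 1)) = σ ^ 2 * σ ^ (-(n * (p - 1))) := by
      rw [sub_eq_add_neg, Real.rpow_add hσ0]; norm_num
    rw [e1, Real.mul_rpow (by norm_num) hσ0.le]
    ring

end DampedWave

/-! ### Exponent arithmetic and conversion into lifespan bounds -/

namespace DampedWave

variable {n : ℕ} {μ p R : ℝ} {f g : Space n → ℝ}

/-- For ν > 1, p_S(ν) is the larger root of the concave quadratic γ_S(·,ν); when p_S = +∞, γ_S is
positive outright. The Fujita alternative is likewise γ_F > 0. -/
theorem lt_pCrit_cases (hn : 1 ≤ n) (hμ : 0 ≤ μ) (hp : 1 < p) (hpc : (p : EReal) < pCrit n μ) :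
    (n - (μ - 1)⁻) * (p - 1) < 2 ∨ 0 < gammaS p (n + μ) := by
  have hn' : (1 : ℝ) ≤ n := by exact_mod_cast hn
  rcases lt_max_iff.1 hpc with h | h
  · left
    rw [pFujita] at h
    split_ifs at h with hν
    · rw [EReal.coe_lt_coe_iff] at h
      have : (p - 1) < 2 / (n - (μ - 1)⁻) := by linarith
      rwa [lt_div_iff₀ hν, mul_comm] at this
    · nlinarith
  · right
    rw [pStrauss] at h
    unfold gammaS
    split_ifs at h with hν
    · rw [EReal.coe_lt_coe_iff, lt_div_iff₀ (by linarith)] at h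
      set ν := (n : ℝ) + μ
      have h1 : p * (2 * (ν - 1)) - (ν + 1) < √(ν ^ 2 + 10 * ν - 7) := by linarith
      -- Squaring is legitimate only in the first case, where the difference of the squares is
      -- 4(ν-1)γ_S. In the second, γ_S > 0 directly.
      rcases le_or_gt (ν + 1 - p * (2 * (ν - 1))) 0 with h0 | h0
      · rw [Real.lt_sqrt (by linarith)] at h1
        have h4 : 0 < (ν - 1) * (2 + (ν + 1) * p - (ν - 1) * p ^ 2) := by nlinarith
        exact pos_of_mul_pos_right h4 (by linarith)
      · nlinarith [mul_pos h0 (by linarith : 0 < p)]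
    · have h1 : (n : ℝ) + μ ≤ 1 := not_lt.1 hν
      nlinarith [sq_nonneg p]

/-- For μ ≥ 1, μ < μ_* means exactly 2n < (n+1-μ)(n+2), that is 2/(n-|μ-1|) < 1 + 2/n = p_F(n). For
μ ≤ 1 the Fujita parameter ν equals n - |μ-1|, and pν ≤ 2 leaves γ_F ≥ ν, with γ_F = 2 if ν = 0. -/
theorem gammaF_pos_of_le (hn : 1 ≤ n) (hμ : 0 ≤ μ) (hμs : μ < muStar n)
    (hp : p * (n - |μ - 1|) ≤ 2) : 0 < gammaF p (n - (μ - 1)⁻) := by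
  have hn' : (1 : ℝ) ≤ n := by exact_mod_cast hn
  unfold gammaF
  rcases le_total 1 μ with h | h
  · rw [abs_of_nonneg (by linarith)] at hp
    rw [negPart_of_nonneg (by linarith)]
    rw [muStar, lt_div_iff₀ (by linarith)] at hμs
    have h1 : 2 * n < (n + 1 - μ) * (n + 2) := by nlinarith
    have h3 : 0 < n + 1 - μ := by
      by_contra! h0
      nlinarith
    have h4 : p * n < n + 2 := by
      by_contra! h0
      nlinarith [mul_le_mul_of_nonneg_right h0 h3.le]
    linarith
  · rw [abs_of_nonpos (by linarith)] at hp
    rw [negPart_of_nonpos (by linarith)]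
    rcases eq_or_lt_of_le (show 0 ≤ (n : ℝ) - -(μ - 1) by linarith) with h0 | h0
    · rw [← h0]; norm_num
    · nlinarith

/-- In this range the Fujita condition implies the Strauss one: γ_S = pγ_F + 2 when μ ≤ 1, and γ_S >
2pγ_F(p,n) when μ ≥ 1. -/
theorem gammaS_pos_of_lt (hn : 1 ≤ n) (hμ : 0 ≤ μ) (hp1 : 1 < p)
    (hpc : (p : EReal) < pCrit n μ) (hp : 2 < p * (n - |μ - 1|)) : 0 < gammaS p (n + μ) := by
  have hn' : (1 : ℝ) ≤ n := by exact_mod_cast hn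
  rcases lt_pCrit_cases hn hμ hp1 hpc with hF | hS
  · unfold gammaS
    rcases le_total 1 μ with h | h
    · rw [abs_of_nonneg (by linarith)] at hp
      rw [negPart_of_nonneg (by linarith), sub_zero] at hF
      have h1 : ((n : ℝ) + μ - 1) * p < 2 * p * n - 2 := by nlinarith
      have h2 := mul_lt_mul_of_pos_right h1 (by linarith : 0 < p - 1)
      have h3 := mul_lt_mul_of_pos_left hF (by linarith : 0 < 2 * p)
      nlinarith
    · rw [negPart_of_nonpos (by linarith)] at hF
      have h3 := mul_lt_mul_of_pos_left hF (by linarith : 0 < p)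
      nlinarith
  · exact hS

/-- For μ ≥ μ_* one has n + μ - 1 ≥ 2n(n+1)/(n+2), so n(p-1) ≥ 2 would force γ_S = 2 + 2p -
(n+μ-1)p(p-1) ≤ 0: the Strauss alternative adds nothing to the Fujita range. -/
theorem gammaF_pos_of_muStar_le (hn : 1 ≤ n) (hp1 : 1 < p)
    (hpc : (p : EReal) < pCrit n μ) (hμs : muStar n ≤ μ) : 0 < gammaF p n := by
  have hn' : (1 : ℝ) ≤ n := by exact_mod_cast hn
  rw [muStar, div_le_iff₀ (by linarith)] at hμs
  have h1 : 1 ≤ μ := by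
    by_contra! h0
    nlinarith
  unfold gammaF
  rcases lt_pCrit_cases hn (by linarith) hp1 hpc with hF | hS
  · rw [negPart_of_nonneg (by linarith), sub_zero] at hF
    linarith
  · by_contra! h0
    unfold gammaS at hS
    have h2 : 2 ≤ n * (p - 1) := by linarith
    have h3 : (2 * (n : ℝ) ^ 2 + 2 * n) ≤ (n + μ - 1) * (n + 2) := by nlinarith
    have h4 : (n + μ - 1) * (p * (p - 1)) < 2 + 2 * p := by nlinarith
    have hpp : 0 < p * (p - 1) := mul_pos (by linarith) (by linarith)
    have h5 := mul_le_mul_of_nonneg_right h3 hpp.le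
    have h6 := mul_lt_mul_of_pos_right h4 (by linarith : (0 : ℝ) < n + 2)
    have h7 := mul_le_mul_of_nonneg_left h2 (by positivity : 0 ≤ 2 * ((n : ℝ) + 1) * p)
    nlinarith

theorem lifespan_le_of_forall {ε X : ℝ}
    (h : ∀ T : ℝ, ∀ u : ℝ → Lp ℝ 2 (volume : Measure (Space n)), IsEnergySolution μ p ε f g T u →
      SupportedInCone R T u → ¬ 2 * X < T) : lifespan μ p R f g ε ≤ ENNReal.ofReal (2 * X) := by
  refine iSup₂_le fun T hT => ?_
  obtain ⟨-, u, hu, hcone⟩ := hT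
  exact ENNReal.ofReal_le_ofReal (not_lt.1 (h T u hu hcone))

/-- If `σ^γ ε^α < K` whenever a solution exists beyond `2σ`, then `T_ε ≤ C ε^{-α/γ}`. -/
theorem exists_lifespan_le_rpow {γ α K : ℝ} (hγ : 0 < γ) (hα : 0 ≤ α)
    (h : ∀ ε : ℝ, 0 < ε → ∀ T : ℝ, ∀ u : ℝ → Lp ℝ 2 (volume : Measure (Space n)),
      IsEnergySolution μ p ε f g T u → SupportedInCone R T u → ∀ σ : ℝ, 2 ≤ σ → 2 * σ < T →
      σ ^ γ * ε ^ α < K) :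
    ∃ C > (0 : ℝ), ∀ ε : ℝ, 0 < ε → ε ≤ 1 →
      lifespan μ p R f g ε ≤ ENNReal.ofReal (C * ε ^ (-(α / γ))) := by
  -- C ≥ 2 makes σ = C ε^{-α/γ} admissible (σ ≥ 2) for ε ≤ 1, and C^γ ≥ K contradicts the hypothesis
  -- at that σ.
  set C := max 2 ((max K 0) ^ (1 / γ)) with hC
  have hC2 : 2 ≤ C := le_max_left _ _
  refine ⟨2 * C, by linarith, fun ε hε hε1 => ?_⟩
  have h1 : 1 ≤ ε ^ (-(α / γ)) :=
    Real.one_le_rpow_of_pos_of_le_one_of_nonpos hε hε1 (by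
      have : 0 ≤ α / γ := by positivity
      linarith)
  rw [mul_assoc]
  refine lifespan_le_of_forall fun T u hu hcone hT => ?_
  have h2 := h ε hε T u hu hcone (C * ε ^ (-(α / γ))) (by nlinarith) hT
  rw [Real.mul_rpow (by linarith) (by positivity), ← Real.rpow_mul hε.le, mul_assoc,
    ← Real.rpow_add hε, neg_mul, div_mul_cancel₀ _ hγ.ne', neg_add_cancel, Real.rpow_zero,
    mul_one] at h2
  have h3 : ((max K 0) ^ (1 / γ)) ^ γ ≤ C ^ γ :=
    Real.rpow_le_rpow (by positivity) (le_max_right _ _) hγ.le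
  rw [← Real.rpow_mul (le_max_right _ _), one_div_mul_cancel hγ.ne', Real.rpow_one] at h3
  linarith [le_max_left K 0]

theorem exists_unique_log_scale {α ε : ℝ} (hα : 0 < α) (hε : 0 < ε) :
    ∃ φ : ℝ, ∀ s : ℝ, (0 < s ∧ ε * s ^ α * Real.log (1 + s) = 1) ↔ s = φ := by
  have hmono : StrictMonoOn (fun s : ℝ => ε * s ^ α * Real.log (1 + s)) (Ici 0) := by
    intro x hx y hy hxy
    have hx0 : (0 : ℝ) ≤ x := hx
    have hy0 : 0 < y := lt_of_le_of_lt hx0 hxy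
    have h1 : x ^ α < y ^ α := Real.rpow_lt_rpow hx0 hxy hα
    have h2 : Real.log (1 + x) < Real.log (1 + y) := Real.log_lt_log (by linarith) (by linarith)
    have h3 : 0 ≤ Real.log (1 + x) := Real.log_nonneg (by linarith)
    have h4 : 0 < y ^ α := by positivity
    simp only
    exact mul_lt_mul'' (mul_lt_mul_of_pos_left h1 hε) h2 (by positivity) h3
  have hcont : ContinuousOn (fun s : ℝ => ε * s ^ α * Real.log (1 + s)) (Ici 0) := by
    refine ContinuousOn.mul (continuousOn_const.mul
      (continuousOn_id.rpow_const fun x _ => Or.inr hα.le)) (ContinuousOn.log (by fun_prop) ?_)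
    intro x hx
    have : (0 : ℝ) ≤ x := hx
    linarith
  -- At exp(1/ε) the logarithm alone outweighs 1/ε, which gives the upper end for the intermediate
  -- value theorem.
  set b := Real.exp (1 / ε)
  have hb : 1 ≤ b := Real.one_le_exp (by positivity)
  have hfb : 1 ≤ ε * b ^ α * Real.log (1 + b) := by
    have h1 : 1 ≤ b ^ α := Real.one_le_rpow hb hα.le
    have h2 : 1 / ε ≤ Real.log (1 + b) := by
      rw [Real.le_log_iff_exp_le (by linarith)]; linarith
    calc 1 = ε * 1 * (1 / ε) := by field_simp
      _ ≤ _ := by gcongr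
  obtain ⟨φ, hφ, hφ1⟩ := intermediate_value_Icc (by linarith : (0 : ℝ) ≤ b)
    (hcont.mono Icc_subset_Ici_self) (show (1 : ℝ) ∈ Icc _ _ from ⟨by simp [hα.ne'], hfb⟩)
  simp only at hφ1
  have hφ0 : 0 < φ := by
    refine lt_of_le_of_ne hφ.1 fun h => ?_
    rw [← h] at hφ1
    simp at hφ1
  refine ⟨φ, fun s => ⟨fun ⟨hs, hs1⟩ => ?_, fun h => h ▸ ⟨hφ0, hφ1⟩⟩⟩
  exact hmono.injOn (mem_Ici.2 hs.le) (mem_Ici.2 hφ0.le) (hs1.trans hφ1.symm)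

/-- Because α ≥ 1, replacing φ by Cφ multiplies the left side by at least C, so it exceeds K at σ =
Cφ. -/
theorem exists_lifespan_le_log_scale {α K : ℝ} (hα : 1 ≤ α)
    (h : ∀ ε : ℝ, 0 < ε → ∀ T : ℝ, ∀ u : ℝ → Lp ℝ 2 (volume : Measure (Space n)),
      IsEnergySolution μ p ε f g T u → SupportedInCone R T u → ∀ σ : ℝ, 2 ≤ σ → 2 * σ < T →
      ε * σ ^ α * Real.log (1 + σ) < K) :
    ∃ C > (0 : ℝ), ∀ ε : ℝ, 0 < ε → ε ≤ 1 → ∃ φ₀ : ℝ,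
      (∀ s : ℝ, (0 < s ∧ ε * s ^ α * Real.log (1 + s) = 1) ↔ s = φ₀) ∧
      lifespan μ p R f g ε ≤ ENNReal.ofReal (C * φ₀) := by
  set C := max 2 K with hC
  have hC2 : 2 ≤ C := le_max_left _ _
  refine ⟨2 * C, by linarith, fun ε hε hε1 => ?_⟩
  obtain ⟨φ, hφ⟩ := exists_unique_log_scale (by linarith : 0 < α) hε
  obtain ⟨hφ0, hφ1⟩ := (hφ φ).2 rfl
  refine ⟨φ, hφ, ?_⟩
  -- For φ < 1 and ε ≤ 1 the product would be less than 1; hence Cφ ≥ 2.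
  have hφge : 1 ≤ φ := by
    by_contra! hlt
    have h1 : φ ^ α ≤ 1 := Real.rpow_le_one hφ0.le hlt.le (by linarith)
    have h2 : Real.log (1 + φ) < 1 := by
      have := Real.log_le_sub_one_of_pos (by linarith : 0 < 1 + φ)
      linarith
    have h3 : 0 < Real.log (1 + φ) := Real.log_pos (by linarith)
    have h4 : ε * φ ^ α ≤ 1 := mul_le_one₀ hε1 (by positivity) h1
    nlinarith
  rw [mul_assoc]
  refine lifespan_le_of_forall fun T u hu hcone hT => ?_
  have h1 := h ε hε T u hu hcone (C * φ) (by nlinarith) hT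
  have h2 : C ≤ C ^ α := Real.self_le_rpow_of_one_le (by linarith) hα
  have h3 : Real.log (1 + φ) ≤ Real.log (1 + C * φ) :=
    Real.log_le_log (by linarith) (by nlinarith)
  have h4 : 0 ≤ Real.log (1 + φ) := Real.log_nonneg (by linarith)
  rw [Real.mul_rpow (by linarith) hφ0.le] at h1
  have h5 : C ≤ ε * (C ^ α * φ ^ α) * Real.log (1 + C * φ) := by
    calc C = C * (ε * φ ^ α * Real.log (1 + φ)) := by rw [hφ1, mul_one]
      _ = ε * (C * φ ^ α) * Real.log (1 + φ) := by ring
      _ ≤ _ := by gcongr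
  linarith [le_max_right 2 K]

/-- If every large ball had nonpositive integral, h would vanish almost everywhere. The radius must
be enlarged because the data are not assumed to be supported, or even nonzero, in the ball of radius
R. -/
theorem exists_closedBall_setIntegral_pos {h : Space n → ℝ} (h2 : MemLp h 2 volume)
    (h0 : ∀ᵐ x, 0 ≤ h x) (hne : ¬ ∀ᵐ x, h x = 0) (R : ℝ) :
    ∃ r, R ≤ r ∧ 0 < ∫ x in Metric.closedBall 0 r, h x := by
  by_contra! hcon
  refine hne ?_
  have hN : ∀ N : ℕ, ∀ᵐ x, x ∈ Metric.closedBall (0 : Space n) (R + N) → h x = 0 := by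
    intro N
    have hfin := isFiniteMeasure_restrict_closedBall (n := n) (R + N)
    have hI : IntegrableOn h (Metric.closedBall (0 : Space n) (R + N)) :=
      (h2.restrict _).integrable (by norm_num)
    have h1 := hcon (R + N) (by linarith [(Nat.cast_nonneg N : (0 : ℝ) ≤ N)])
    have h0' : 0 ≤ᵐ[volume.restrict (Metric.closedBall (0 : Space n) (R + N))] h :=
      ae_restrict_of_ae h0
    have h3 := (setIntegral_eq_zero_iff_of_nonneg_ae h0' hI).1
      (le_antisymm h1 (integral_nonneg_of_ae h0'))
    exact (ae_restrict_iff' Metric.isClosed_closedBall.measurableSet).1 h3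
  filter_upwards [ae_all_iff.2 hN] with x hx
  obtain ⟨N, hN⟩ := exists_nat_ge (‖x‖ - R)
  exact hx N (mem_closedBall_zero_iff.2 (by linarith))

end DampedWave

/-! ### The lifespan theorem -/

/-- The condition p ≤ 2/(n-|μ-1|) is written as a product, so the vanishing denominator at n = 1, μ
= 0 falls into the first regime. -/
theorem theorem1p1 (n : ℕ) (hn : 1 ≤ n) (μ p R : ℝ) (hμ : 0 ≤ μ) (hp : 1 < p)
    (hpc : (p : EReal) < DampedWave.pCrit n μ) (hR : 1 ≤ R)
    (f g : DampedWave.Space n → ℝ) (hf : DampedWave.MemH1 f) (hg : MemLp g 2 volume)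
    (hf_nonneg : ∀ᵐ x, 0 ≤ f x)
    (hh_nonneg : ∀ᵐ x, 0 ≤ (μ - 1)⁺ * f x + g x)
    (hh_ne : ¬ ∀ᵐ x, (μ - 1)⁺ * f x + g x = 0) :
    ∃ ε₁ > (0 : ℝ), ∃ C > (0 : ℝ), ∀ ε : ℝ, 0 < ε → ε ≤ ε₁ →
      (μ < DampedWave.muStar n →
        (p * (n - |μ - 1|) ≤ 2 →
          DampedWave.lifespan μ p R f g ε ≤
            ENNReal.ofReal (C * ε ^ (-((p - 1) / DampedWave.gammaF p (n - (μ - 1)⁻))))) ∧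
        (2 < p * (n - |μ - 1|) →
          DampedWave.lifespan μ p R f g ε ≤
            ENNReal.ofReal (C * ε ^ (-(2 * p * (p - 1) / DampedWave.gammaS p (n + μ)))))) ∧
      (DampedWave.muStar n ≤ μ →
        DampedWave.lifespan μ p R f g ε ≤
            ENNReal.ofReal (C * ε ^ (-((p - 1) / DampedWave.gammaF p n))) ∧
        ε ^ (-((p - 1) / DampedWave.gammaF p n)) = ε ^ (-(2 / (p - 1) - n)⁻¹)) ∧
      (n = 1 → μ = 1 → p ≤ 2 →
        ∃ φ₀ : ℝ,
          (∀ s : ℝ, (0 < s ∧ ε * s ^ (2 / (p - 1) - 1) * Real.log (1 + s) = 1) ↔ s = φ₀) ∧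
          DampedWave.lifespan μ p R f g ε ≤ ENNReal.ofReal (C * φ₀)) := by
  open DampedWave in
  have hp1 : 0 < p - 1 := by linarith
  set d := (μ - 1)⁺ with hd
  have hd0 : 0 ≤ d := posPart_nonneg _
  have hdm : d - (μ - 1)⁻ = μ - 1 := posPart_sub_negPart _
  -- This is b = min(μ,1), so that 1 - b = [μ-1]₋ is the growth exponent of the mass.
  set b := 1 - (μ - 1)⁻ with hb
  have hbd : b + d = μ := by rw [hb]; linarith
  have hw : d = 0 ∨ b = 1 := by
    rcases le_total (μ - 1) 0 with h | h
    · left; rw [hd]; exact posPart_of_nonpos h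
    · right; rw [hb, negPart_of_nonneg h, sub_zero]
  have hb0 : 0 ≤ b := by
    rcases hw with h | h <;> linarith
  obtain ⟨r, hRr, hr⟩ := exists_closedBall_setIntegral_pos ((hf.1.const_mul d).add hg)
    hh_nonneg hh_ne R
  obtain ⟨k, hk, K, hK, hmass⟩ := exists_mass_bounds hn hp (by linarith : 0 ≤ r) hb0 hd0 hbd hw
    hf.1 hg hf_nonneg hh_nonneg hr
  -- Support in the cone of opening radius R is support in the larger cone of radius r, so all mass
  -- bounds hold with r.
  have hcone : ∀ {T : ℝ} {u : ℝ → Lp ℝ 2 (volume : Measure (Space n))},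
      SupportedInCone R T u → SupportedInCone r T u := fun h t ht => by
    filter_upwards [h t ht] with x hx hxr using hx (by linarith)
  have fujita : 0 < gammaF p (n - (μ - 1)⁻) → ∃ C > (0 : ℝ), ∀ ε : ℝ, 0 < ε → ε ≤ 1 →
      lifespan μ p R f g ε ≤ ENNReal.ofReal (C * ε ^ (-((p - 1) / gammaF p (n - (μ - 1)⁻)))) := by
    intro hγ
    refine exists_lifespan_le_rpow (K := K / k ^ (p - 1)) hγ hp1.le
      fun ε hε T u hu hc σ hσ hσT => ?_
    obtain ⟨F, h1, -, -, h4⟩ := hmass ε hε T u hu (hcone hc) σ hσ hσT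
    have hσ0 : 0 < σ := by linarith
    have := h4 _ (by positivity) h1
    rw [lt_div_iff₀ (by positivity)]
    refine lt_of_eq_of_lt ?_ this
    rw [Real.mul_rpow (by positivity) (by positivity), Real.mul_rpow hk.le hε.le,
      ← Real.rpow_mul hσ0.le]
    have e : σ ^ gammaF p (n - (μ - 1)⁻) = σ ^ (2 - n * (p - 1)) * σ ^ ((1 - b) * (p - 1)) := by
      rw [← Real.rpow_add hσ0]
      congr 1
      rw [gammaF, hb]; ring
    rw [e]; ring
  have strauss : 0 < gammaS p (n + μ) → ∃ C > (0 : ℝ), ∀ ε : ℝ, 0 < ε → ε ≤ 1 →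
      lifespan μ p R f g ε ≤ ENNReal.ofReal (C * ε ^ (-(2 * p * (p - 1) / gammaS p (n + μ)))) := by
    intro hγ
    have e0 : 2 * p * (p - 1) / gammaS p (n + μ) = p * (p - 1) / (gammaS p (n + μ) / 2) := by
      field_simp
    rw [e0]
    refine exists_lifespan_le_rpow (K := K / k ^ (p - 1)) (half_pos hγ) (by positivity)
      fun ε hε T u hu hc σ hσ hσT => ?_
    obtain ⟨F, -, -, h3, h4⟩ := hmass ε hε T u hu (hcone hc) σ hσ hσT
    have hσ0 : 0 < σ := by linarith
    have := h4 _ (by positivity) h3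
    rw [lt_div_iff₀ (by positivity)]
    refine lt_of_eq_of_lt ?_ this
    rw [Real.mul_rpow (by positivity) (by positivity), Real.mul_rpow hk.le (by positivity),
      ← Real.rpow_mul hσ0.le, ← Real.rpow_mul hε.le]
    have e : σ ^ (gammaS p (n + μ) / 2) =
        σ ^ (2 - n * (p - 1)) * σ ^ (((n : ℝ) + 1 - (n + μ - 1) * p / 2) * (p - 1)) := by
      rw [← Real.rpow_add hσ0]
      congr 1
      rw [gammaS]; ring
    rw [e]; ring
  have critical : n = 1 → μ = 1 → p ≤ 2 → ∃ C > (0 : ℝ), ∀ ε : ℝ, 0 < ε → ε ≤ 1 → ∃ φ₀ : ℝ,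
      (∀ s : ℝ, (0 < s ∧ ε * s ^ (2 / (p - 1) - 1) * Real.log (1 + s) = 1) ↔ s = φ₀) ∧
      lifespan μ p R f g ε ≤ ENNReal.ofReal (C * φ₀) := by
    intro hn1 hμ1 hp2
    have hα : 1 ≤ 2 / (p - 1) - 1 := by
      have : 2 ≤ 2 / (p - 1) := by rw [le_div_iff₀ hp1]; linarith
      linarith
    -- The mass inequality is the (p-1)-th power of the desired one: (2/(p-1) - 1)(p-1) = 3 - p = 2
    -- - n(p-1) for n = 1.
    refine exists_lifespan_le_log_scale (K := (K / k ^ (p - 1)) ^ (1 / (p - 1))) hα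
      fun ε hε T u hu hc σ hσ hσT => ?_
    obtain ⟨F, -, h2, -, h4⟩ := hmass ε hε T u hu (hcone hc) σ hσ hσT
    have hσ0 : 0 < σ := by linarith
    have hlog : 0 < Real.log (1 + σ) := Real.log_pos (by linarith)
    have hb1 : b = 1 := by rw [hb, hμ1]; simp
    have h5 := h4 _ (by positivity) (h2 hb1 (by linarith))
    have h6 : (ε * σ ^ (2 / (p - 1) - 1) * Real.log (1 + σ)) ^ (p - 1) < K / k ^ (p - 1) := by
      rw [lt_div_iff₀ (by positivity)]
      refine lt_of_eq_of_lt ?_ h5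
      rw [Real.mul_rpow (by positivity) hlog.le, Real.mul_rpow hε.le (by positivity),
        Real.mul_rpow (by positivity) hlog.le, Real.mul_rpow hk.le hε.le, ← Real.rpow_mul hσ0.le]
      have e : (2 / (p - 1) - 1) * (p - 1) = 2 - n * (p - 1) := by
        rw [hn1]; field_simp; push_cast; ring
      rw [e]; ring
    have h7 := Real.rpow_lt_rpow (by positivity) h6 (by positivity : 0 < 1 / (p - 1))
    rwa [← Real.rpow_mul (by positivity), mul_one_div_cancel hp1.ne', Real.rpow_one] at h7
  -- Each constant is obtained only inside its own regime; outside it any positive value serves, so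
  -- the sum of the three is a constant common to all regimes, with ε₁ = 1.
  have guard : ∀ {A : Prop} {P : ℝ → Prop}, (A → ∃ C > (0 : ℝ), P C) →
      ∃ C > (0 : ℝ), A → P C := fun {A P} h => by
    by_cases hA : A
    · obtain ⟨C, hC, hP⟩ := h hA
      exact ⟨C, hC, fun _ => hP⟩
    · exact ⟨1, one_pos, fun h => absurd h hA⟩
  obtain ⟨C₁, hC₁, h₁⟩ := guard fujita
  obtain ⟨C₂, hC₂, h₂⟩ := guard strauss
  obtain ⟨C₃, hC₃, h₃⟩ := guard fun h : n = 1 ∧ μ = 1 ∧ p ≤ 2 => critical h.1 h.2.1 h.2.2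
  refine ⟨1, one_pos, C₁ + C₂ + C₃, by positivity, fun ε hε hε1 => ⟨fun hμs => ⟨fun hle => ?_,
    fun hlt => ?_⟩, fun hμs => ?_, fun hn1 hμ1 hp2 => ?_⟩⟩
  · refine (h₁ (gammaF_pos_of_le hn hμ hμs hle) ε hε hε1).trans (ENNReal.ofReal_le_ofReal ?_)
    gcongr
    linarith
  · refine (h₂ (gammaS_pos_of_lt hn hμ hp hpc hlt) ε hε hε1).trans (ENNReal.ofReal_le_ofReal ?_)
    gcongr
    linarith
  · have hμ1 : 1 ≤ μ := by
      have hn' : (1 : ℝ) ≤ n := by exact_mod_cast hn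
      refine le_trans ?_ hμs
      rw [muStar, le_div_iff₀ (by linarith)]
      nlinarith
    have hγ := gammaF_pos_of_muStar_le hn hp hpc hμs
    have e : (n : ℝ) - (μ - 1)⁻ = n := by rw [negPart_of_nonneg (by linarith), sub_zero]
    rw [e] at h₁
    refine ⟨(h₁ hγ ε hε hε1).trans (ENNReal.ofReal_le_ofReal ?_), ?_⟩
    · gcongr
      linarith
    · congr 2
      rw [gammaF] at hγ ⊢
      rw [show (2 / (p - 1) - n : ℝ) = (2 - n * (p - 1)) / (p - 1) by field_simp, inv_div]
  · obtain ⟨φ₀, hφ, hlife⟩ := h₃ ⟨hn1, hμ1, hp2⟩ ε hε hε1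
    refine ⟨φ₀, hφ, hlife.trans (ENNReal.ofReal_le_ofReal ?_)⟩
    have hφ0 : 0 < φ₀ := ((hφ φ₀).2 rfl).1
    gcongr
    linarith
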